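/- Let $\mathbf{x}=(x_1,x_2,\ldots)$ and $\mathbf{t}=(t_1,t_2,\ldots)$ be two infinite sequences of variables. **Forests.** An *indexed forest* is an infinite sequence $F=(T_1,T_2,\ldots)$ of binary plane trees (each node has either two children, a left and a right one, or none) of which all but finitely many are the one-node tree; $\mathsf{Forest}$ is the set of indexed forests, and $\emptyset$ is the forest all of whose trees have one node. The leaves of $F$ are labeled $1,2,3,\ldots$ from left to right. A node is *terminal* if it has two children and both are leaves. $\operatorname{Qdes}(F)$ is the set of the labels of the left children of the terminal nodes of $F$. For $i\in\operatorname{Qdes}(F)$ let $F/i$ be the indexed forest obtained from $F$ by replacing the terminal node whose left child has label $i$ by a leaf. **Operators.** For $f\in\mathbb Z[\mathbf t][\mathbf x]$ and $i\ge 1$ put $$\mathsf E_i f=\frac{f(x_1,\ldots,x_{i-1},x_i,t_i,x_{i+1},\ldots;\mathbf t)-f(x_1,\ldots,x_{i-1},t_i,x_i,x_{i+1},\ldots;\mathbf t)}{x_i-t_i}\in\mathbb Z[\mathbf t][\mathbf x],$$ and for $f\in\mathbb Z[\mathbf x]$ put $$\mathsf T_i f=\frac{f(x_1,\ldots,x_{i-1},x_i,0,x_{i+1},\ldots)-f(x_1,\ldots,x_{i-1},0,x_i,x_{i+1},\ldots)}{x_i}\in\mathbb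 Z[\mathbf x].$$ Let $\widehat{\mathbf t}_i=(t_1,\ldots,t_{i-1},t_{i+1},\ldots)$. **Polynomials.** The *double forest polynomials* are the unique family of polynomials $\mathfrak P_F(\mathbf x;\mathbf t)\in\mathbb Z[\mathbf t][\mathbf x]$, $F\in\mathsf{Forest}$, homogeneous in the variables $\mathbf x,\mathbf t$ together, such that $\mathfrak P_\emptyset(\mathbf t;\mathbf t)=1$, $\mathfrak P_F(\mathbf t;\mathbf t)=0$ for $F\ne\emptyset$, and, for all $F$ and $i$, $\mathsf E_i\mathfrak P_F(\mathbf x;\mathbf t)=\mathfrak P_{F/i}(\mathbf x;\widehat{\mathbf t}_i)$ if $i\in\operatorname{Qdes}(F)$ and $\mathsf E_i\mathfrak P_F(\mathbf x;\mathbf t)=0$ otherwise. The (ordinary) *forest polynomials* are the unique family of homogeneous polynomials $\mathfrak P_F(\mathbf x)\in\mathbb Z[\mathbf x]$, $F\in\mathsf{Forest}$, such that $\mathfrak P_\emptyset(\mathbf x)=1$ and, for all $F$ and $i$, $\mathsf T_i\mathfrak P_F=\mathfrak P_{F/i}$ if $i\in\operatorname{Qdes}(F)$ and $\mathsf T_i\mathfrak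 P_F=0$ otherwise. **Corollary 4.5.** Both families exist and are unique, and: * for every $F\in\mathsf{Forest}$, $\mathfrak P_F(\mathbf x;\mathbf 0)=\mathfrak P_F(\mathbf x)$; * the family $\{\mathfrak P_F(\mathbf x;\mathbf t)\mid F\in\mathsf{Forest}\}$ is a $\mathbb Z[\mathbf t]$-basis of $\mathbb Z[\mathbf t][\mathbf x]$; * for every $n\ge 0$, the family $\{\mathfrak P_F(\mathbf x;\mathbf t)\mid F\in\mathsf{Forest},\ \operatorname{Qdes}(F)\subset\{1,\ldots,n\}\}$ is a $\mathbb Z[\mathbf t]$-basis of $\mathbb Z[\mathbf t][x_1,\ldots,x_n]$. -/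

import Mathlib

/-! Indexing convention: the positive integers `1, 2, 3, …` which number the variables `x`, the
variables `t`, the trees of an indexed forest and its leaves are represented by `0, 1, 2, …`;
so `X 0` is the first variable, and the set `[n] = {1, …, n}` becomes `Set.Iio n`. -/

namespace DoubleForest

/-! ### Indexed forests -/

/-- An indexed forest: a sequence of binary plane trees, all but finitely many of which are the
trivial tree `∗ = BinaryTree.nil`. (In `BinaryTree Unit`, `nil` is a leaf and `node` an internal
node with a left and a right child.) -/
@[ext]
structure IndexedForest where
  tree : ℕ → BinaryTree Unit
  finite_nontrivial : {k | tree k ≠ BinaryTree.nil}.Finite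

/-- For a tree whose leaves are numbered consecutively from left to right, starting with `a`:
the set of the flags `ρ(v)`, with `v` running over the terminal nodes (the internal nodes whose
two children are leaves). The flag of a terminal node is the number of its left leaf. -/
def treeQdes (a : ℕ) : BinaryTree Unit → Set ℕ
  | .nil => ∅
  | .node _ l r =>
      if l = .nil ∧ r = .nil then {a}
      else treeQdes a l ∪ treeQdes (a + l.numLeaves) r

/-- For a tree whose leaves are numbered consecutively from left to right, starting with `a`:
delete (that is, replace by a leaf) the terminal node with flag `i`, if there is one. -/
def treeTrim (i a : ℕ) : BinaryTree Unit → BinaryTree Unit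
  | .nil => .nil
  | .node u l r =>
      if l = .nil ∧ r = .nil then (if a = i then .nil else .node u l r)
      else .node u (treeTrim i a l) (treeTrim i (a + l.numLeaves) r)

namespace IndexedForest

/-- The empty forest: all trees are trivial. -/
def empty : IndexedForest where
  tree _ := .nil
  finite_nontrivial := by simp

/-- The number of the leftmost leaf of the `k`-th tree, the leaves of the whole forest being
numbered consecutively from left to right. -/
def firstLeaf (F : IndexedForest) (k : ℕ) : ℕ :=
  ∑ j ∈ Finset.range k, (F.tree j).numLeaves

/-- `Qdes F`, the set of the flags `ρ_F(v)` of the terminal nodes `v` of `F`. -/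
def qdes (F : IndexedForest) : Set ℕ :=
  ⋃ k, treeQdes (F.firstLeaf k) (F.tree k)

/-- The trimmed forest `F / i` (of interest for `i ∈ Qdes F`): the terminal node with flag `i`
is deleted. -/
def trim (F : IndexedForest) (i : ℕ) : IndexedForest where
  tree k := treeTrim i (F.firstLeaf k) (F.tree k)
  finite_nontrivial := by
    refine F.finite_nontrivial.subset fun k hk h => hk ?_
    simp [h, treeTrim]

end IndexedForest

/-! ### Polynomials, equivariant trimming operations -/

/-- The ring `ℤ[t]`, with `t = (t₁, t₂, …)`; also used for `ℤ[x]`. -/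
abbrev Poly : Type := MvPolynomial ℕ ℤ

/-- The ring `ℤ[t][x]`. The variable `x_i` is `X i`, the variable `t_i` is `C (X i)`. -/
abbrev PolyTX : Type := MvPolynomial ℕ Poly

open MvPolynomial

/-- `R_i^- f = f(x₁, …, x_{i-1}, t_i, x_i, x_{i+1}, …; t)`. -/
noncomputable def rMinus (i : ℕ) : PolyTX →ₐ[Poly] PolyTX :=
  aeval fun j => if j < i then X j else if j = i then C (X i) else X (j - 1)

/-- `R_i^+ f = f(x₁, …, x_{i-1}, x_i, t_i, x_{i+1}, …; t)`. -/
noncomputable def rPlus (i : ℕ) : PolyTX →ₐ[Poly] PolyTX :=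
  aeval fun j => if j ≤ i then X j else if j = i + 1 then C (X i) else X (j - 1)

theorem dvd_rPlus_sub_rMinus (i : ℕ) (f : PolyTX) :
    (X i - C (X i) : PolyTX) ∣ rPlus i f - rMinus i f := by
  induction f using MvPolynomial.induction_on with
  | C a => simp [rPlus, rMinus]
  | add p q hp hq =>
    rw [map_add, map_add, add_sub_add_comm]
    exact dvd_add hp hq
  | mul_X p j hp =>
    have hj : (X i - C (X i) : PolyTX) ∣ rPlus i (X j) - rMinus i (X j) := by
      simp only [rPlus, rMinus, aeval_X]
      rcases lt_trichotomy j i with h | h | h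
      · simp [h, h.le]
      · simp [h]
      · by_cases h' : j = i + 1
        · subst h'
          simpa using dvd_sub_comm.1 (dvd_refl (X i - C (X i) : PolyTX))
        · simp [h', not_le.2 h, not_lt.2 h.le, h.ne']
    have e : rPlus i (p * X j) - rMinus i (p * X j)
        = (rPlus i p - rMinus i p) * rPlus i (X j)
          + rMinus i p * (rPlus i (X j) - rMinus i (X j)) := by
      rw [map_mul, map_mul]; ring
    rw [e]
    exact dvd_add (hp.mul_right _) (hj.mul_left _)

/-- The equivariant trimming operation `E_i f = (R_i^+ f - R_i^- f) / (x_i - t_i)`. -/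
noncomputable def eqTrim (i : ℕ) (f : PolyTX) : PolyTX :=
  Classical.choose (dvd_rPlus_sub_rMinus i f)

theorem eqTrim_spec (i : ℕ) (f : PolyTX) :
    rPlus i f - rMinus i f = (X i - C (X i)) * eqTrim i f :=
  Classical.choose_spec (dvd_rPlus_sub_rMinus i f)

/-- `f(x; t) ↦ f(x; t̂_i)`, where `t̂_i = (t₁, …, t_{i-1}, t_{i+1}, …)`. -/
noncomputable def hatT (i : ℕ) : PolyTX →+* PolyTX :=
  MvPolynomial.map
    (rename (fun j => if j < i then j else j + 1) : Poly →ₐ[ℤ] Poly).toRingHom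

/-- `f(x; t) ↦ f(t; t)`. -/
noncomputable def evalT : PolyTX →+* Poly := MvPolynomial.eval fun j => X j

/-- `f(x; t) ↦ f(x; 0)`. -/
noncomputable def setTZero : PolyTX →+* Poly :=
  MvPolynomial.map (MvPolynomial.eval fun _ => (0 : ℤ))

/-- `f` is homogeneous, with respect to the total degree in all the variables `x` and `t`. -/
def IsHomog (f : PolyTX) : Prop :=
  ∃ d : ℕ, ((sumAlgEquiv ℤ ℕ ℕ).symm f).IsHomogeneous d

/-! ### Double forest polynomials -/

/-- The characterization of the family of the double forest polynomials. -/
structure IsDoubleForestFamily (D : IndexedForest → PolyTX) : Prop where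
  homog : ∀ F, IsHomog (D F)
  evalT_empty : evalT (D .empty) = 1
  evalT_ne : ∀ F, F ≠ .empty → evalT (D F) = 0
  eqTrim_mem : ∀ F, ∀ i ∈ F.qdes, eqTrim i (D F) = hatT i (D (F.trim i))
  eqTrim_notMem : ∀ F, ∀ i ∉ F.qdes, eqTrim i (D F) = 0

/-- The double forest polynomials `𝔓_F(x; t)`: the unique family with the above properties. -/
noncomputable def doubleForestPoly : IndexedForest → PolyTX :=
  Classical.epsilon IsDoubleForestFamily

/-! ### Ordinary forest polynomials -/

/-- The Bergeron–Sottile map `R_i f = f(x₁, …, x_{i-1}, 0, x_i, x_{i+1}, …)`. -/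
noncomputable def bs (i : ℕ) : Poly →ₐ[ℤ] Poly :=
  aeval fun j => if j < i then X j else if j = i then 0 else X (j - 1)

theorem dvd_bs_sub_bs (i : ℕ) (f : Poly) : (X i : Poly) ∣ bs (i + 1) f - bs i f := by
  induction f using MvPolynomial.induction_on with
  | C a => simp [bs]
  | add p q hp hq =>
    rw [map_add, map_add, add_sub_add_comm]
    exact dvd_add hp hq
  | mul_X p j hp =>
    have hj : (X i : Poly) ∣ bs (i + 1) (X j) - bs i (X j) := by
      simp only [bs, aeval_X]
      rcases lt_trichotomy j i with h | h | h
      · simp [h, Nat.lt_succ_of_lt h]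
      · simp [h]
      · by_cases h' : j = i + 1
        · subst h'
          simp
        · have h1 : ¬ j < i + 1 := by omega
          simp [h', h1, not_lt.2 h.le, h.ne']
    have e : bs (i + 1) (p * X j) - bs i (p * X j)
        = (bs (i + 1) p - bs i p) * bs (i + 1) (X j)
          + bs i p * (bs (i + 1) (X j) - bs i (X j)) := by
      rw [map_mul, map_mul]; ring
    rw [e]
    exact dvd_add (hp.mul_right _) (hj.mul_left _)

/-- The trimming operation `T_i f = (R_{i+1} f - R_i f) / x_i`. -/
noncomputable def ordTrim (i : ℕ) (f : Poly) : Poly :=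
  Classical.choose (dvd_bs_sub_bs i f)

theorem ordTrim_spec (i : ℕ) (f : Poly) :
    bs (i + 1) f - bs i f = X i * ordTrim i f :=
  Classical.choose_spec (dvd_bs_sub_bs i f)

/-- The characterization of the family of the (ordinary) forest polynomials. -/
structure IsForestFamily (P : IndexedForest → Poly) : Prop where
  homog : ∀ F, ∃ d : ℕ, (P F).IsHomogeneous d
  empty : P .empty = 1
  ordTrim_mem : ∀ F, ∀ i ∈ F.qdes, ordTrim i (P F) = P (F.trim i)
  ordTrim_notMem : ∀ F, ∀ i ∉ F.qdes, ordTrim i (P F) = 0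

/-- The forest polynomials `𝔓_F(x)`: the unique family with the above properties. -/
noncomputable def forestPoly : IndexedForest → Poly :=
  Classical.epsilon IsForestFamily

/-- `ℤ[t][x₁, …, x_n]`, as a `ℤ[t]`-submodule of `ℤ[t][x]`. -/
noncomputable def polyTXn (n : ℕ) : Submodule Poly PolyTX :=
  Subalgebra.toSubmodule (MvPolynomial.supported Poly (Set.Iio n))

end DoubleForest

/-! Trimming a forest `F` down to the empty one while applying the corresponding operators `trimOp`,
dropping the parameter used at each stage, and then setting `x = t`, gives a linear functional
`forestCoeff t F`. It does not depend on the order of trimming (`forestCoeff_grow`): two removals in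
a forest commute up to a shift of labels (`grow_grow`), and the operators satisfy the same relation
(`trimOp_trimOp`).

These functionals are jointly injective (`eq_zero_of_forestCoeff_eq_zero`), and only finitely many
are nonzero on a given polynomial. Hence at most one family is dual to them, and such a family is a
basis in which `forestCoeff t F` reads off coefficients. The trimming recursion together with the
values at `x = t` amounts to duality (`isDualFamily_of_trimOp`, `IsDualFamily.trimOp_mem`), so
uniqueness, both basis statements and the specialization at `t = 0` become statements about dual
families.

Existence is proved first at `t = 0`, by induction on the number of internal nodes: a finitely
supported family `g i` satisfying the commutation relations is of the form `trimOp i 0 f`, with an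
explicit `f` (`exists_trimOp_zero_eq`). Ordinary forest polynomials, regarded as free of `t`, are
then dual to the functionals up to a unitriangular error. Bihomogeneity leaves only smaller forests
in the error, which is subtracted recursively (`exists_dual`). -/

namespace DoubleForest

open BinaryTree

/-! ### Growing forests -/

/-- The number of the leaf `a` after the leaf `i` has been split into two leaves; for `a = i`,
the number of the left one of the two. -/
def bump (i a : ℕ) : ℕ := if i < a then a + 1 else a

/-- For a tree whose leaves are numbered consecutively from left to right, starting with `a`:
replace the leaf `i`, if there is one, by a terminal node. -/
def treeGrow (i a : ℕ) : BinaryTree Unit → BinaryTree Unit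
  | .nil => if a = i then .node () .nil .nil else .nil
  | .node u l r => .node u (treeGrow i a l) (treeGrow i (a + l.numLeaves) r)

/-- The label just after a tree transforms by the same rule as its first label, wherever the split
leaf lies. This lets the inductions pass from a left subtree to the right one, and from a tree of a
forest to the next. -/
theorem bump_add_numLeaves_treeGrow (i a : ℕ) (T : BinaryTree Unit) :
    bump i a + (treeGrow i a T).numLeaves = bump i (a + T.numLeaves) := by
  induction T generalizing a with
  | nil =>
    change bump i a + (if a = i then node () nil nil else nil : BinaryTree Unit).numLeaves
      = bump i (a + 1)
    unfold bump
    split_ifs <;> simp only [numLeaves] <;> omega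
  | node u l r hl hr =>
    simp only [treeGrow, numLeaves]
    rw [← add_assoc, hl, hr, add_assoc]

theorem treeGrow_eq_nil {i a : ℕ} {T : BinaryTree Unit} (h : treeGrow i a T = .nil) :
    T = .nil ∧ a ≠ i := by
  cases T with
  | nil =>
    refine ⟨rfl, fun h' => ?_⟩
    simp [treeGrow, h'] at h
  | node u l r => simp [treeGrow] at h

theorem treeTrim_treeGrow (i a : ℕ) (T : BinaryTree Unit) :
    treeTrim i (bump i a) (treeGrow i a T) = T := by
  induction T generalizing a with
  | nil =>
    by_cases h : a = i
    · simp [treeGrow, treeTrim, h, bump]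
    · simp [treeGrow, treeTrim, h]
  | node u l r hl hr =>
    simp only [treeGrow, treeTrim]
    split_ifs with h h'
    · obtain ⟨h1, h2⟩ := treeGrow_eq_nil h.1
      simp only [bump] at h'
      split_ifs at h' <;> omega
    · rw [h.1, h.2, (treeGrow_eq_nil h.1).1, (treeGrow_eq_nil h.2).1]
    · rw [bump_add_numLeaves_treeGrow, hl, hr]

theorem treeGrow_of_notMem {i a : ℕ} {T : BinaryTree Unit} (h : i < a ∨ a + T.numLeaves ≤ i) :
    treeGrow i a T = T := by
  induction T generalizing a with
  | nil =>
    simp only [numLeaves] at h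
    simp only [treeGrow]
    rw [if_neg (by omega)]
  | node u l r hl hr =>
    simp only [numLeaves] at h
    simp only [treeGrow]
    have := l.numLeaves_pos
    have := r.numLeaves_pos
    rw [hl (by omega), hr (by omega)]

theorem mem_treeQdes_treeGrow {i a : ℕ} {T : BinaryTree Unit} (h1 : a ≤ i)
    (h2 : i < a + T.numLeaves) : i ∈ treeQdes a (treeGrow i a T) := by
  induction T generalizing a with
  | nil =>
    simp only [numLeaves] at h2
    have : a = i := by omega
    simp [treeGrow, treeQdes, this]
  | node u l r hl hr =>
    simp only [numLeaves] at h2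
    simp only [treeGrow, treeQdes]
    split_ifs with h
    · obtain ⟨h3, h4⟩ := treeGrow_eq_nil h.1
      obtain ⟨h5, h6⟩ := treeGrow_eq_nil h.2
      subst h3 h5
      simp only [numLeaves] at h2 h6
      omega
    · by_cases h3 : i < a + l.numLeaves
      · exact Or.inl (hl h1 h3)
      · right
        have h4 := bump_add_numLeaves_treeGrow i a l
        simp only [bump] at h4
        rw [if_neg (by omega), if_neg (by omega)] at h4
        rw [h4]
        exact hr (by omega) (by omega)

theorem treeQdes_bounds {i a : ℕ} {T : BinaryTree Unit} (h : i ∈ treeQdes a T) :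
    a ≤ i ∧ i + 1 < a + T.numLeaves := by
  induction T generalizing a with
  | nil => simp [treeQdes] at h
  | node u l r hl hr =>
    simp only [treeQdes] at h
    simp only [numLeaves]
    have := l.numLeaves_pos
    have := r.numLeaves_pos
    split_ifs at h
    · rw [Set.mem_singleton_iff] at h
      omega
    · rcases h with h | h
      · have := hl h
        omega
      · have := hr h
        omega

theorem treeQdes_nonempty {a : ℕ} {T : BinaryTree Unit} (h : T ≠ .nil) :
    (treeQdes a T).Nonempty := by
  induction T generalizing a with
  | nil => exact absurd rfl h
  | node u l r hl hr =>
    simp only [treeQdes]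
    split_ifs with h'
    · exact Set.singleton_nonempty _
    · rw [not_and_or] at h'
      rcases h' with h' | h'
      · exact (hl h').mono Set.subset_union_left
      · exact (hr h').mono Set.subset_union_right

theorem treeTrim_of_notMem {i a : ℕ} {T : BinaryTree Unit} (h : i ∉ treeQdes a T) :
    treeTrim i a T = T := by
  induction T generalizing a with
  | nil => rfl
  | node u l r hl hr =>
    simp only [treeQdes] at h
    simp only [treeTrim]
    split_ifs at h ⊢ with h1 h2
    · exact absurd h2.symm h
    · rfl
    · rw [Set.mem_union, not_or] at h
      rw [hl h.1, hr h.2]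

theorem numLeaves_treeTrim {i a : ℕ} {T : BinaryTree Unit} (h : i ∈ treeQdes a T) :
    (treeTrim i a T).numLeaves + 1 = T.numLeaves := by
  induction T generalizing a with
  | nil => simp [treeQdes] at h
  | node u l r hl hr =>
    simp only [treeQdes] at h
    simp only [treeTrim]
    split_ifs at h ⊢ with h1 h2
    · simp [h1]
    · exact absurd h.symm h2
    · simp only [numLeaves]
      rcases h with h | h
      · rw [treeTrim_of_notMem (T := r) fun h' => by
          have := treeQdes_bounds h
          have := treeQdes_bounds h'
          omega, ← hl h]
        omega
      · rw [treeTrim_of_notMem (T := l) fun h' => by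
          have := treeQdes_bounds h
          have := treeQdes_bounds h'
          omega, ← hr h]
        omega

theorem treeGrow_treeTrim {i a : ℕ} {T : BinaryTree Unit} (h : i ∈ treeQdes a T) :
    treeGrow i a (treeTrim i a T) = T := by
  induction T generalizing a with
  | nil => simp [treeQdes] at h
  | node u l r hl hr =>
    simp only [treeQdes] at h
    simp only [treeTrim]
    split_ifs at h ⊢ with h1 h2
    · simp [treeGrow, h1, h2]
    · exact absurd h.symm h2
    · rcases h with h | h
      · have h3 := treeQdes_bounds h
        have h4 := numLeaves_treeTrim h
        rw [treeTrim_of_notMem (T := r) fun h' => by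
          have := treeQdes_bounds h'
          omega]
        simp only [treeGrow]
        rw [hl h, treeGrow_of_notMem (Or.inl (by omega))]
      · have h3 := treeQdes_bounds h
        rw [treeTrim_of_notMem (T := l) fun h' => by
          have := treeQdes_bounds h'
          omega]
        simp only [treeGrow]
        rw [hr h, treeGrow_of_notMem (Or.inr (by omega))]

theorem treeGrow_treeGrow {i k : ℕ} (hik : i < k) (a : ℕ) (T : BinaryTree Unit) :
    treeGrow i (bump k a) (treeGrow k a T) = treeGrow (k + 1) (bump i a) (treeGrow i a T) := by
  induction T generalizing a with
  | nil =>
    by_cases h1 : a = k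
    · subst h1
      have h2 : a + 1 ≠ i := by omega
      simp [treeGrow, bump, hik, hik.ne', h2]
    · by_cases h2 : a = i
      · subst h2
        have h3 : ¬ k < a := by omega
        have h4 : a ≠ k + 1 := by omega
        simp [treeGrow, bump, h1, h3, h4]
      · simp only [treeGrow, if_neg h1, if_neg h2, bump]
        rw [if_neg, if_neg] <;> split_ifs <;> omega
  | node u l r hl hr =>
    simp only [treeGrow]
    rw [bump_add_numLeaves_treeGrow, bump_add_numLeaves_treeGrow, hl, hr]

/-- Splitting leaf `i` shifts every later flag by one. The case `k = i` is excluded because leaf `i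
+ 1` is then the right child of the new terminal node. -/
theorem mem_treeQdes_of_mem_treeGrow {i k a : ℕ} (hik : i ≤ k) {T : BinaryTree Unit}
    (h : k + 1 ∈ treeQdes (bump i a) (treeGrow i a T)) : i < k ∧ k ∈ treeQdes a T := by
  induction T generalizing a with
  | nil =>
    by_cases h1 : a = i
    · simp only [treeGrow, h1, if_true, treeQdes, bump, lt_irrefl, if_false, and_self,
        Set.mem_singleton_iff] at h
      omega
    · simp [treeGrow, h1, treeQdes] at h
  | node u l r hl hr =>
    simp only [treeGrow, treeQdes] at h
    split_ifs at h with h1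
    · obtain ⟨h3, h4⟩ := treeGrow_eq_nil h1.1
      obtain ⟨h5, h6⟩ := treeGrow_eq_nil h1.2
      rw [Set.mem_singleton_iff] at h
      simp only [bump] at h
      simp only [treeQdes, h3, h5, and_self, if_true, Set.mem_singleton_iff]
      split_ifs at h <;> omega
    · rw [bump_add_numLeaves_treeGrow] at h
      simp only [treeQdes]
      rcases h with h | h
      · obtain ⟨h2, h3⟩ := hl h
        refine ⟨h2, ?_⟩
        rw [if_neg]
        · exact Or.inl h3
        · rintro ⟨rfl, -⟩
          simp [treeQdes] at h3
      · obtain ⟨h2, h3⟩ := hr h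
        refine ⟨h2, ?_⟩
        rw [if_neg]
        · exact Or.inr h3
        · rintro ⟨-, rfl⟩
          simp [treeQdes] at h3

/-! ### Growing and trimming indexed forests -/

namespace IndexedForest

theorem firstLeaf_succ (F : IndexedForest) (k : ℕ) :
    F.firstLeaf (k + 1) = F.firstLeaf k + (F.tree k).numLeaves :=
  Finset.sum_range_succ _ _

theorem firstLeaf_mono (F : IndexedForest) : Monotone F.firstLeaf :=
  monotone_nat_of_le_succ fun k => by rw [firstLeaf_succ]; omega

theorem le_firstLeaf (F : IndexedForest) (k : ℕ) : k ≤ F.firstLeaf k := by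
  induction k with
  | zero => exact Nat.zero_le _
  | succ k ih =>
    have := (F.tree k).numLeaves_pos
    rw [firstLeaf_succ]
    omega

/-- The forest obtained by replacing the leaf `i` by a terminal node. -/
def grow (i : ℕ) (F : IndexedForest) : IndexedForest where
  tree k := treeGrow i (F.firstLeaf k) (F.tree k)
  finite_nontrivial := by
    refine (F.finite_nontrivial.union (Set.finite_Iic i)).subset fun k hk => ?_
    by_contra h
    rw [Set.mem_union, not_or, Set.mem_Iic, not_le] at h
    refine hk ?_
    rw [treeGrow_of_notMem (Or.inl (h.2.trans_le (F.le_firstLeaf k)))]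
    simpa using h.1

theorem firstLeaf_grow (i : ℕ) (F : IndexedForest) (k : ℕ) :
    (grow i F).firstLeaf k = bump i (F.firstLeaf k) := by
  induction k with
  | zero => simp [firstLeaf, bump]
  | succ k ih => rw [firstLeaf_succ, ih, firstLeaf_succ, ← bump_add_numLeaves_treeGrow]; rfl

theorem trim_grow (i : ℕ) (F : IndexedForest) : (grow i F).trim i = F := by
  ext k
  simp only [trim, firstLeaf_grow]
  exact treeTrim_treeGrow _ _ _

theorem mem_qdes_grow (i : ℕ) (F : IndexedForest) : i ∈ (grow i F).qdes := by
  -- The least such `k` is the index of the tree that contains leaf `i`.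
  have hex : ∃ k, i < F.firstLeaf (k + 1) := ⟨i, F.le_firstLeaf (i + 1)⟩
  classical
  have h1 := Nat.find_spec hex
  have h2 : F.firstLeaf (Nat.find hex) ≤ i := by
    rcases h : Nat.find hex with _ | m
    · exact Nat.zero_le _
    · exact not_lt.1 (Nat.find_min hex (by omega))
  refine Set.mem_iUnion.2 ⟨Nat.find hex, ?_⟩
  rw [firstLeaf_grow, bump, if_neg (not_lt.2 h2)]
  exact mem_treeQdes_treeGrow h2 (by rwa [← firstLeaf_succ])

theorem grow_grow {i k : ℕ} (hik : i < k) (F : IndexedForest) :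
    grow i (grow k F) = grow (k + 1) (grow i F) := by
  ext m
  simp only [grow]
  erw [firstLeaf_grow, firstLeaf_grow]
  exact treeGrow_treeGrow hik _ _

theorem mem_qdes_of_mem_grow {i k : ℕ} (hik : i ≤ k) {F : IndexedForest}
    (h : k + 1 ∈ (grow i F).qdes) : i < k ∧ k ∈ F.qdes := by
  obtain ⟨m, hm⟩ := Set.mem_iUnion.1 h
  rw [firstLeaf_grow] at hm
  have := mem_treeQdes_of_mem_treeGrow hik hm
  exact ⟨this.1, Set.mem_iUnion.2 ⟨m, this.2⟩⟩

theorem grow_trim {i : ℕ} {F : IndexedForest} (h : i ∈ F.qdes) : grow i (F.trim i) = F := by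
  obtain ⟨m, hm⟩ := Set.mem_iUnion.1 h
  have hb := treeQdes_bounds hm
  rw [← firstLeaf_succ] at hb
  -- The bound is `i + 1`, not `i`: trimming lowers the labels of the later trees by one, and they
  -- must still exceed `i` afterwards.
  have hout : ∀ k, k ≠ m → i + 1 < F.firstLeaf k ∨ F.firstLeaf k + (F.tree k).numLeaves ≤ i := by
    intro k hk
    rcases lt_or_gt_of_ne hk with hk | hk
    · right
      rw [← firstLeaf_succ]
      exact (F.firstLeaf_mono hk).trans hb.1
    · left
      exact hb.2.trans_le (F.firstLeaf_mono hk)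
  have htree : ∀ k, k ≠ m → (F.trim i).tree k = F.tree k := fun k hk =>
    treeTrim_of_notMem fun h' => by
      have := treeQdes_bounds h'
      have := hout k hk
      omega
  have hleaf : ∀ k, k ≤ m → (F.trim i).firstLeaf k = F.firstLeaf k := fun k hk =>
    Finset.sum_congr rfl fun j hj => by
      rw [htree j (by rw [Finset.mem_range] at hj; omega)]
  have hleaf' : ∀ k, m < k → (F.trim i).firstLeaf k + 1 = F.firstLeaf k := by
    intro k hk
    induction k, hk using Nat.le_induction with
    | base =>
      rw [firstLeaf_succ, firstLeaf_succ, hleaf m le_rfl, ← numLeaves_treeTrim hm]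
      rfl
    | succ k hk ih => rw [firstLeaf_succ, firstLeaf_succ, ← ih, htree k (by omega)]; omega
  ext k
  change treeGrow i ((F.trim i).firstLeaf k) ((F.trim i).tree k) = F.tree k
  rcases lt_trichotomy k m with hk | rfl | hk
  · rw [htree k hk.ne, hleaf k hk.le]
    refine treeGrow_of_notMem ?_
    have := hout k hk.ne
    omega
  · rw [hleaf k le_rfl]
    exact treeGrow_treeTrim hm
  · rw [htree k hk.ne']
    refine treeGrow_of_notMem (Or.inl ?_)
    have := hleaf' k hk
    have := F.firstLeaf_mono (show m + 1 ≤ k from hk)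
    omega

theorem grow_injective (i : ℕ) : Function.Injective (grow i) :=
  fun F G h => by
  rw [← trim_grow i F, h, trim_grow]

/-- The number of internal nodes. -/
noncomputable def size (F : IndexedForest) : ℕ := ∑ᶠ k, (F.tree k).numNodes

/-- A tree has one more leaf than internal nodes, so far to the right the labels record the size.
The effect of growing on the size is then read off from a single label shift. -/
theorem eventually_firstLeaf (F : IndexedForest) :
    ∀ᶠ k in Filter.atTop, F.firstLeaf k = k + F.size := by
  obtain ⟨m, hm⟩ := F.finite_nontrivial.bddAbove
  filter_upwards [Filter.eventually_gt_atTop m] with k hk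
  have : Function.support (fun j => (F.tree j).numNodes) ⊆ Finset.range k := by
    intro j hj
    have : F.tree j ≠ .nil := fun h => by simp [h] at hj
    simpa using (hm this).trans_lt hk
  rw [size, finsum_eq_sum_of_support_subset _ this, firstLeaf]
  simp only [numLeaves_eq_numNodes_succ]
  rw [Finset.sum_add_distrib]
  simp [add_comm]

theorem size_grow (i : ℕ) (F : IndexedForest) : (grow i F).size = F.size + 1 := by
  obtain ⟨k, h1, h2, h3⟩ := ((eventually_firstLeaf F).and
    ((eventually_firstLeaf (grow i F)).and (Filter.eventually_gt_atTop i))).exists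
  have := F.le_firstLeaf k
  rw [firstLeaf_grow, bump, if_pos (by omega)] at h2
  omega

theorem size_trim {i : ℕ} {F : IndexedForest} (h : i ∈ F.qdes) :
    (F.trim i).size + 1 = F.size := by
  rw [← size_grow i, grow_trim h]

@[simp] theorem size_empty : empty.size = 0 := by simp [size, empty]

@[simp] theorem qdes_empty : empty.qdes = ∅ := by simp [qdes, empty, treeQdes]

theorem qdes_nonempty {F : IndexedForest} (h : F ≠ empty) : F.qdes.Nonempty := by
  by_contra h'
  refine h ?_
  ext k
  by_contra hk
  exact h' ((treeQdes_nonempty hk).mono (Set.subset_iUnion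
    (fun k => treeQdes (F.firstLeaf k) (F.tree k)) k))

theorem exists_eq_grow {F : IndexedForest} (h : F ≠ empty) : ∃ i G, F = grow i G :=
  (qdes_nonempty h).imp fun _ hi => ⟨_, (grow_trim hi).symm⟩

theorem size_pos {F : IndexedForest} (h : F ≠ empty) : 0 < F.size := by
  obtain ⟨i, G, rfl⟩ := exists_eq_grow h
  rw [size_grow]
  omega

@[elab_as_elim]
theorem grow_induction {p : IndexedForest → Prop} (empty : p empty)
    (grow : ∀ i F, p F → p (grow i F)) (F : IndexedForest) : p F := by
  induction h : F.size generalizing F with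
  | zero =>
    by_cases hF : F = .empty
    · rwa [hF]
    · have := size_pos hF
      omega
  | succ n ih =>
    by_cases hF : F = .empty
    · rwa [hF]
    · obtain ⟨i, G, rfl⟩ := exists_eq_grow hF
      rw [size_grow] at h
      exact grow i G (ih G (by omega))

theorem qdes_bddAbove (F : IndexedForest) : ∃ m, ∀ i ∈ F.qdes, i < m := by
  obtain ⟨m, hm⟩ := F.finite_nontrivial.bddAbove
  refine ⟨F.firstLeaf (m + 1), fun i hi => ?_⟩
  obtain ⟨k, hk⟩ := Set.mem_iUnion.1 hi
  have h1 : F.tree k ≠ .nil := fun h => by simp [h, treeQdes] at hk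
  have h2 : k ≤ m := hm h1
  have h3 := treeQdes_bounds hk
  have h4 := F.firstLeaf_mono (show k + 1 ≤ m + 1 by omega)
  rw [firstLeaf_succ] at h4
  omega

/-- Two distinct terminal nodes of a forest can be deleted in either order. -/
theorem exists_eq_grow_grow {i j : ℕ} (hij : i < j) {F : IndexedForest} (hi : i ∈ F.qdes)
    (hj : j ∈ F.qdes) : ∃ k G, i < k ∧ j = k + 1 ∧ F = grow i (grow k G) := by
  obtain ⟨k, rfl⟩ : ∃ k, j = k + 1 := ⟨j - 1, by omega⟩
  rw [← grow_trim hi] at hj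
  obtain ⟨h1, h2⟩ := mem_qdes_of_mem_grow (by omega) hj
  exact ⟨k, (F.trim i).trim k, h1, rfl, by rw [grow_trim h2, grow_trim hi]⟩

end IndexedForest

end DoubleForest

namespace DoubleForest

open MvPolynomial IndexedForest

/-! ### Trimming operations with an arbitrary parameter -/

section Operators

variable {R S : Type*} [CommRing R] [CommRing S]

/-- `f ↦ f(x₁, …, x_{i-1}, a, x_i, x_{i+1}, …)`. -/
noncomputable def ins (i : ℕ) (a : R) : MvPolynomial ℕ R →ₐ[R] MvPolynomial ℕ R :=
  aeval fun j => if j < i then X j else if j = i then C a else X (j - 1)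

theorem ins_X_of_lt {i j : ℕ} (h : j < i) (a : R) : ins i a (X j) = X j := by
  simp [ins, h]

theorem ins_X_self (i : ℕ) (a : R) : ins i a (X i) = C a := by
  simp [ins]

theorem ins_X_succ {i j : ℕ} (h : i ≤ j) (a : R) : ins i a (X (j + 1)) = X j := by
  have h1 : ¬ j + 1 < i := by omega
  have h2 : j + 1 ≠ i := by omega
  simp [ins, h1, h2]

theorem ins_C (i : ℕ) (a r : R) : ins i a (C r) = C r := by
  simp [ins]

theorem ins_ins {i k : ℕ} (h : i ≤ k) (a b : R) (f : MvPolynomial ℕ R) :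
    ins i a (ins (k + 1) b f) = ins k b (ins i a f) := by
  induction f using MvPolynomial.induction_on with
  | C r => simp only [ins_C]
  | add p q hp hq => simp only [map_add, hp, hq]
  | mul_X p j hp =>
    simp only [map_mul, hp]
    congr 1
    rcases lt_trichotomy j i with hj | rfl | hj
    · rw [ins_X_of_lt (by omega), ins_X_of_lt hj, ins_X_of_lt (by omega)]
    · rw [ins_X_of_lt (by omega), ins_X_self, ins_C]
    · obtain ⟨j, rfl⟩ : ∃ m, j = m + 1 := ⟨j - 1, by omega⟩
      rw [ins_X_succ (show i ≤ j by omega)]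
      rcases lt_trichotomy j k with hk | rfl | hk
      · rw [ins_X_of_lt (by omega), ins_X_of_lt hk, ins_X_succ (by omega)]
      · rw [ins_X_self, ins_X_self, ins_C]
      · rw [ins_X_succ (by omega)]
        obtain ⟨j, rfl⟩ : ∃ m, j = m + 1 := ⟨j - 1, by omega⟩
        rw [ins_X_succ (by omega), ins_X_succ (by omega)]

theorem map_ins (φ : R →+* S) (i : ℕ) (a : R) (f : MvPolynomial ℕ R) :
    map φ (ins i a f) = ins i (φ a) (map φ f) := by
  induction f using MvPolynomial.induction_on with
  | C r => simp only [ins_C, map_C]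
  | add p q hp hq => simp only [map_add, hp, hq]
  | mul_X p j hp =>
    simp only [map_mul, hp, map_X]
    congr 1
    simp only [ins, aeval_X]
    split_ifs <;> simp

theorem dvd_ins_sub_ins (i : ℕ) (a : R) (f : MvPolynomial ℕ R) :
    X i - C a ∣ ins (i + 1) a f - ins i a f := by
  induction f using MvPolynomial.induction_on with
  | C r => simp only [ins_C, sub_self, dvd_zero]
  | add p q hp hq =>
    rw [map_add, map_add, add_sub_add_comm]
    exact dvd_add hp hq
  | mul_X p j hp =>
    have hj : X i - C a ∣ ins (i + 1) a (X j) - ins i a (X j) := by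
      rcases lt_trichotomy j i with h | rfl | h
      · rw [ins_X_of_lt (by omega), ins_X_of_lt h, sub_self]
        exact dvd_zero _
      · rw [ins_X_of_lt (by omega), ins_X_self]
      · obtain ⟨j, rfl⟩ : ∃ m, j = m + 1 := ⟨j - 1, by omega⟩
        rw [ins_X_succ (Nat.le_of_lt_succ h)]
        rcases (Nat.le_of_lt_succ h).eq_or_lt with rfl | h'
        · rw [ins_X_self, dvd_sub_comm]
        · rw [ins_X_succ (Nat.succ_le_of_lt h'), sub_self]
          exact dvd_zero _
    have e : ins (i + 1) a (p * X j) - ins i a (p * X j)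
        = (ins (i + 1) a p - ins i a p) * ins (i + 1) a (X j)
          + ins i a p * (ins (i + 1) a (X j) - ins i a (X j)) := by
      rw [map_mul, map_mul]; ring
    rw [e]
    exact dvd_add (hp.mul_right _) (hj.mul_left _)

theorem X_sub_C_ne_zero [Nontrivial R] (i : ℕ) (a : R) : (X i - C a : MvPolynomial ℕ R) ≠ 0 := by
  intro h
  have := congrArg (eval fun _ => a + 1) h
  simp at this

theorem exists_mem_supported (f : MvPolynomial ℕ R) : ∃ n, f ∈ supported R (Set.Iio n) := by
  obtain ⟨m, hm⟩ := f.vars.bddAbove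
  exact ⟨m + 1, mem_supported.2 fun i hi => Nat.lt_succ_of_le (hm hi)⟩

theorem ins_of_mem_supported {n i : ℕ} (h : n ≤ i) (a : R) {f : MvPolynomial ℕ R}
    (hf : f ∈ supported R (Set.Iio n)) : ins i a f = f := by
  induction hf using Algebra.adjoin_induction with
  | mem x hx =>
    obtain ⟨j, hj, rfl⟩ := hx
    exact ins_X_of_lt (hj.trans_le h) a
  | algebraMap r => exact ins_C i a r
  | add p q _ _ hp hq => rw [map_add, hp, hq]
  | mul p q _ _ hp hq => rw [map_mul, hp, hq]

theorem supported_Iio_mono {m n : ℕ} (h : m ≤ n) :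
    supported R (Set.Iio m) ≤ supported R (Set.Iio n) :=
  supported_mono (Set.Iio_subset_Iio h)

variable [IsDomain R] [IsDomain S]

/-- `f ↦ (f(x₁, …, x_i, a, x_{i+1}, …) - f(x₁, …, x_{i-1}, a, x_i, …)) / (x_i - a)`. -/
noncomputable def trimOp (i : ℕ) (a : R) : MvPolynomial ℕ R →ₗ[R] MvPolynomial ℕ R where
  toFun f := (dvd_ins_sub_ins i a f).choose
  map_add' f g := by
    apply mul_left_cancel₀ (X_sub_C_ne_zero i a)
    rw [mul_add, ← (dvd_ins_sub_ins i a (f + g)).choose_spec,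
      ← (dvd_ins_sub_ins i a f).choose_spec, ← (dvd_ins_sub_ins i a g).choose_spec,
      map_add, map_add]
    ring
  map_smul' r f := by
    apply mul_left_cancel₀ (X_sub_C_ne_zero i a)
    rw [RingHom.id_apply, mul_smul_comm, ← (dvd_ins_sub_ins i a (r • f)).choose_spec,
      ← (dvd_ins_sub_ins i a f).choose_spec, map_smul, map_smul, smul_sub]

theorem trimOp_spec (i : ℕ) (a : R) (f : MvPolynomial ℕ R) :
    (X i - C a) * trimOp i a f = ins (i + 1) a f - ins i a f :=
  (dvd_ins_sub_ins i a f).choose_spec.symm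

theorem trimOp_eq {i : ℕ} {a : R} {f g : MvPolynomial ℕ R}
    (h : ins (i + 1) a f - ins i a f = (X i - C a) * g) : trimOp i a f = g :=
  mul_left_cancel₀ (X_sub_C_ne_zero i a) ((trimOp_spec i a f).trans h)

theorem trimOp_mul (i : ℕ) (a : R) (f g : MvPolynomial ℕ R) :
    trimOp i a (f * g) = trimOp i a f * ins (i + 1) a g + ins i a f * trimOp i a g := by
  apply trimOp_eq
  rw [mul_add, ← mul_assoc, trimOp_spec, mul_left_comm, trimOp_spec, map_mul, map_mul]
  ring

theorem trimOp_C (i : ℕ) (a r : R) : trimOp i a (C r) = 0 :=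
  trimOp_eq (by rw [ins_C, ins_C, sub_self, mul_zero])

theorem trimOp_X_of_lt {i j : ℕ} (h : j < i) (a : R) : trimOp i a (X j) = 0 :=
  trimOp_eq (by rw [ins_X_of_lt h, ins_X_of_lt (by omega), sub_self, mul_zero])

theorem trimOp_X_self (i : ℕ) (a : R) : trimOp i a (X i) = 1 :=
  trimOp_eq (by rw [ins_X_of_lt (by omega), ins_X_self, mul_one])

theorem trimOp_X_succ_self (i : ℕ) (a : R) : trimOp i a (X (i + 1)) = -1 :=
  trimOp_eq (by rw [ins_X_self, ins_X_succ le_rfl]; ring)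

theorem trimOp_X_of_gt {i j : ℕ} (h : i < j) (a : R) : trimOp i a (X (j + 1)) = 0 :=
  trimOp_eq (by rw [ins_X_succ h, ins_X_succ h.le, sub_self, mul_zero])

/-- After multiplication by `(X i - C a) * (X k - C b)` both sides become the same alternating sum
of four double insertions, which `ins_ins` matches. -/
theorem trimOp_trimOp {i k : ℕ} (h : i < k) (a b : R) (f : MvPolynomial ℕ R) :
    trimOp k b (trimOp i a f) = trimOp i a (trimOp (k + 1) b f) := by
  apply mul_left_cancel₀ (X_sub_C_ne_zero i a)
  apply mul_left_cancel₀ (X_sub_C_ne_zero k b)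
  have h1 : ∀ j g, i < j → (X i - C a) * ins j b g = ins j b ((X i - C a) * g) :=
    fun j g hj => by rw [map_mul, map_sub, ins_X_of_lt hj, ins_C]
  have h2 : ∀ j g, j ≤ k → (X k - C b) * ins j a g = ins j a ((X (k + 1) - C b) * g) :=
    fun j g hj => by rw [map_mul, map_sub, ins_X_succ hj, ins_C]
  rw [mul_left_comm, trimOp_spec, trimOp_spec, mul_sub, mul_sub, h1 _ _ (by omega), h1 _ _ h,
    h2 _ _ h, h2 _ _ h.le]
  simp only [trimOp_spec, map_sub]
  rw [ins_ins (show i ≤ k + 1 by omega), ins_ins (show i + 1 ≤ k + 1 by omega), ins_ins h,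
    ins_ins h.le]
  ring

theorem map_trimOp (φ : R →+* S) (i : ℕ) (a : R) (f : MvPolynomial ℕ R) :
    map φ (trimOp i a f) = trimOp i (φ a) (map φ f) := by
  symm
  apply trimOp_eq
  rw [← map_ins, ← map_ins, ← map_sub, ← trimOp_spec]
  simp

theorem totalDegree_ins_le (i : ℕ) (a : R) (f : MvPolynomial ℕ R) :
    (ins i a f).totalDegree ≤ f.totalDegree := by
  rw [ins, aeval_def, eval₂_eq]
  refine totalDegree_finsetSum_le fun d hd => ?_
  rw [← C_eq_algebraMap]
  refine (totalDegree_mul _ _).trans ?_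
  rw [totalDegree_C, zero_add]
  refine (totalDegree_finsetProd _ _).trans (le_trans ?_ (le_totalDegree hd))
  refine Finset.sum_le_sum fun j _ => (totalDegree_pow _ _).trans ?_
  refine (Nat.mul_le_mul_left _ (?_ : _ ≤ 1)).trans (mul_one _).le
  split_ifs <;> simp

/-- Degree in `x` alone: insertion does not raise it and the divisor has positive degree. This
drives the inductions on polynomials below. -/
theorem totalDegree_trimOp_lt {i : ℕ} {a : R} {f : MvPolynomial ℕ R} (h : trimOp i a f ≠ 0) :
    (trimOp i a f).totalDegree < f.totalDegree := by
  have h1 := congrArg totalDegree (trimOp_spec i a f)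
  rw [totalDegree_mul_of_isDomain (X_sub_C_ne_zero i a) h] at h1
  have h2 : (X i - C a : MvPolynomial ℕ R).totalDegree ≠ 0 := by
    intro h3
    rw [totalDegree_eq_zero_iff_eq_C] at h3
    have h4 := congrArg (coeff (Finsupp.single i 1)) h3
    have h5 : (0 : ℕ →₀ ℕ) ≠ Finsupp.single i 1 := fun h => by
      have := DFunLike.congr_fun h i
      simp at this
    simp [coeff_C, h5] at h4
  have h3 := totalDegree_sub (ins (i + 1) a f) (ins i a f)
  have h4 := totalDegree_ins_le (i + 1) a f
  have h5 := totalDegree_ins_le i a f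
  have h6 := max_le h4 h5
  omega

theorem ins_mem_supported {n i : ℕ} (h : i ≤ n) (a : R) {f : MvPolynomial ℕ R}
    (hf : f ∈ supported R (Set.Iio (n + 1))) : ins i a f ∈ supported R (Set.Iio n) := by
  induction hf using Algebra.adjoin_induction with
  | mem x hx =>
    obtain ⟨j, hj, rfl⟩ := hx
    rw [Set.mem_Iio] at hj
    rcases lt_trichotomy j i with h' | rfl | h'
    · rw [ins_X_of_lt h', X_mem_supported]
      exact h'.trans_le h
    · rw [ins_X_self]
      exact Subalgebra.algebraMap_mem _ a
    · obtain ⟨j, rfl⟩ : ∃ m, j = m + 1 := ⟨j - 1, by omega⟩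
      rw [ins_X_succ (by omega), X_mem_supported, Set.mem_Iio]
      omega
  | algebraMap r => exact (ins_C i a r).symm ▸ Subalgebra.algebraMap_mem _ r
  | add p q _ _ hp hq => exact map_add (ins i a) p q ▸ add_mem hp hq
  | mul p q _ _ hp hq => exact map_mul (ins i a) p q ▸ mul_mem hp hq

theorem trimOp_of_mem_supported {n i : ℕ} (h : n ≤ i) (a : R) {f : MvPolynomial ℕ R}
    (hf : f ∈ supported R (Set.Iio n)) : trimOp i a f = 0 :=
  trimOp_eq (by
    rw [ins_of_mem_supported h a hf, ins_of_mem_supported (by omega) a hf, sub_self, mul_zero])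

/-- If `X m` is the last variable that may occur, vanishing of the `m`-th trim says that `f = ins m
(t m) f`, and the right side is free of `X m`. The variables are removed one at a time. -/
theorem mem_supported_of_trimOp_eq_zero {n : ℕ} (t : ℕ → R) {f : MvPolynomial ℕ R}
    (h : ∀ i, n ≤ i → trimOp i (t i) f = 0) : f ∈ supported R (Set.Iio n) := by
  obtain ⟨m, hm⟩ := exists_mem_supported f
  induction m with
  | zero => exact supported_Iio_mono n.zero_le hm
  | succ m ih =>
    rcases le_or_gt (m + 1) n with hn | hn
    · exact supported_Iio_mono hn hm
    · refine ih ?_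
      have h1 := trimOp_spec m (t m) f
      rw [h m (by omega), mul_zero, ins_of_mem_supported le_rfl _ hm] at h1
      rw [sub_eq_zero.1 h1.symm]
      exact ins_mem_supported le_rfl _ hm

end Operators

/-! ### The functionals dual to the double forest polynomials -/

/-- `t ↦ (t₁, …, t_{i-1}, t_{i+1}, …)`. -/
def removeAt {R : Type*} (i : ℕ) (t : ℕ → R) (j : ℕ) : R := if j < i then t j else t (j + 1)

theorem removeAt_removeAt {R : Type*} {i k : ℕ} (h : i ≤ k) (t : ℕ → R) :
    removeAt k (removeAt i t) = removeAt i (removeAt (k + 1) t) := by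
  funext j
  unfold removeAt
  split_ifs <;> first | rfl | omega

section Functionals

variable {R S : Type*} [CommRing R] [CommRing S] [IsDomain R] [IsDomain S]

/-- Trim the forest `n` times, and evaluate at `t`. -/
noncomputable def coeffAux :
    ℕ → (ℕ → R) → IndexedForest → MvPolynomial ℕ R →ₗ[R] R
  | 0, t, _ => (aeval t).toLinearMap
  | n + 1, t, F =>
    open Classical in
    if h : F.qdes.Nonempty then
      coeffAux n (removeAt h.some t) (F.trim h.some) ∘ₗ trimOp h.some (t h.some)
    -- A filler value: when the counter equals the size of `F`, a positive counter forces a terminal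
    -- node to exist.
    else (aeval t).toLinearMap

/-- The functional `f ↦ (E_F f)(t; t)`, where `E_F` is the composition of the trimming operations
along any sequence of trimmings from `F` to the empty forest. -/
noncomputable def forestCoeff (t : ℕ → R) (F : IndexedForest) : MvPolynomial ℕ R →ₗ[R] R :=
  coeffAux F.size t F

theorem forestCoeff_empty (t : ℕ → R) (f : MvPolynomial ℕ R) :
    forestCoeff t .empty f = eval t f := by
  simp [forestCoeff, coeffAux, aeval_eq_eval]

theorem forestCoeff_grow (t : ℕ → R) (i : ℕ) (F : IndexedForest) (f : MvPolynomial ℕ R) :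
    forestCoeff t (grow i F) f = forestCoeff (removeAt i t) F (trimOp i (t i) f) := by
  induction h : F.size using Nat.strong_induction_on generalizing t i F f with
  | _ n ih =>
    -- Removing two terminal nodes in either order gives the same functional. The main proof
    -- compares the flag `i` with the flag `j` that the definition happens to choose.
    have comm : ∀ (i k : ℕ) (G : IndexedForest), i < k → G.size < n →
        forestCoeff (removeAt i t) (grow k G) (trimOp i (t i) f)
          = forestCoeff (removeAt (k + 1) t) (grow i G) (trimOp (k + 1) (t (k + 1)) f) := by
      intro i k G hik hG
      rw [ih _ hG _ _ _ _ rfl, ih _ hG _ _ _ _ rfl, removeAt_removeAt hik.le]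
      have h1 : removeAt i t k = t (k + 1) := if_neg (by omega)
      have h2 : removeAt (k + 1) t i = t i := if_pos (by omega)
      rw [h1, h2, trimOp_trimOp hik]
    have hne : (grow i F).qdes.Nonempty := ⟨i, mem_qdes_grow i F⟩
    have hj := hne.some_mem
    rw [forestCoeff, size_grow, coeffAux, dif_pos hne]
    have hs := size_trim hj
    rw [size_grow, Nat.add_right_cancel_iff] at hs
    rw [← hs, LinearMap.comp_apply]
    change forestCoeff _ _ _ = _
    generalize hne.some = j at hj hs
    rcases lt_trichotomy i j with hij | rfl | hij
    · obtain ⟨k, G, hik, rfl, hG⟩ := exists_eq_grow_grow hij (mem_qdes_grow i F) hj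
      obtain rfl := grow_injective i hG
      rw [grow_grow hik, trim_grow]
      exact (comm i k G hik (by rw [← h, size_grow]; omega)).symm
    · rw [trim_grow]
    · obtain ⟨k, G, hik, rfl, hG⟩ := exists_eq_grow_grow hij hj (mem_qdes_grow i F)
      have hG' := hG
      rw [grow_grow hik] at hG'
      obtain rfl := grow_injective _ hG'
      rw [hG, trim_grow]
      exact comm j k G hik (by rw [← h, size_grow]; omega)

theorem forestCoeff_of_mem (t : ℕ → R) {i : ℕ} {F : IndexedForest} (h : i ∈ F.qdes)
    (f : MvPolynomial ℕ R) :
    forestCoeff t F f = forestCoeff (removeAt i t) (F.trim i) (trimOp i (t i) f) := by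
  rw [← forestCoeff_grow, grow_trim h]

theorem map_forestCoeff (φ : R →+* S) {t : ℕ → R} {s : ℕ → S} (h : ∀ i, φ (t i) = s i)
    (F : IndexedForest) (f : MvPolynomial ℕ R) :
    φ (forestCoeff t F f) = forestCoeff s F (map φ f) := by
  induction F using grow_induction generalizing t s f with
  | empty =>
    rw [forestCoeff_empty, forestCoeff_empty, eval_map, ← coe_eval₂Hom, ← (funext h : _ = s),
      ← RingHom.comp_apply]
    congr 1
    ext <;> simp
  | grow i F ih =>
    rw [forestCoeff_grow, forestCoeff_grow, ih (s := removeAt i s), map_trimOp, h]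
    intro j
    unfold removeAt
    split_ifs <;> exact h _

/-- Each trim of `f` is killed by all functionals for the shortened parameters, so it vanishes by
induction on the degree. Then `f` is a constant, which the functional of the empty forest detects.
-/
theorem eq_zero_of_forestCoeff_eq_zero {t : ℕ → R} {f : MvPolynomial ℕ R}
    (h : ∀ F, forestCoeff t F f = 0) : f = 0 := by
  induction hd : f.totalDegree using Nat.strong_induction_on generalizing t f with
  | _ d ih =>
    have h0 : ∀ i, 0 ≤ i → trimOp i (t i) f = 0 := by
      intro i _
      by_contra hne
      exact hne (ih _ (hd ▸ totalDegree_trimOp_lt hne) (t := removeAt i t)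
        (fun F => by rw [← forestCoeff_grow, h]) rfl)
    have h1 := mem_supported_of_trimOp_eq_zero t h0
    have h2 : Set.Iio (0 : ℕ) = ∅ := by ext; simp
    rw [h2, supported_empty, Algebra.mem_bot] at h1
    obtain ⟨r, rfl⟩ := h1
    have h3 := h .empty
    rw [forestCoeff_empty, algebraMap_eq, eval_C] at h3
    rw [h3, map_zero]

theorem ext_forestCoeff {t : ℕ → R} {f g : MvPolynomial ℕ R}
    (h : ∀ F, forestCoeff t F f = forestCoeff t F g) : f = g :=
  sub_eq_zero.1 (eq_zero_of_forestCoeff_eq_zero fun F => by rw [map_sub, h, sub_self])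

theorem forestCoeff_of_mem_supported (t : ℕ → R) {n i : ℕ} {F : IndexedForest} (hi : i ∈ F.qdes)
    (hn : n ≤ i) {f : MvPolynomial ℕ R} (hf : f ∈ supported R (Set.Iio n)) :
    forestCoeff t F f = 0 := by
  rw [forestCoeff_of_mem t hi, trimOp_of_mem_supported hn _ hf, map_zero]

/-- A nonempty forest contributing to `f` has all its flags among the finitely many indices of
variables in use, and trimming one of them lowers the degree. -/
theorem finite_forestCoeff_ne_zero (t : ℕ → R) (f : MvPolynomial ℕ R) :
    {F | forestCoeff t F f ≠ 0}.Finite := by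
  induction hd : f.totalDegree using Nat.strong_induction_on generalizing t f with
  | _ d ih =>
    obtain ⟨n, hn⟩ := exists_mem_supported f
    have key : ∀ i, {G | forestCoeff (removeAt i t) G (trimOp i (t i) f) ≠ 0}.Finite := by
      intro i
      by_cases h0 : trimOp i (t i) f = 0
      · simp [h0]
      · exact ih _ (hd ▸ totalDegree_trimOp_lt h0) _ _ rfl
    refine ((Set.finite_singleton IndexedForest.empty).union ((Set.finite_Iio n).biUnion
      fun i _ => (key i).image (grow i))).subset fun F hF => ?_
    by_cases h0 : F = .empty
    · exact Or.inl h0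
    · obtain ⟨i, hi⟩ := qdes_nonempty h0
      refine Or.inr (Set.mem_biUnion (x := i) ?_ ⟨F.trim i, ?_, grow_trim hi⟩)
      · by_contra h1
        exact hF (forestCoeff_of_mem_supported t hi (not_lt.1 h1) hn)
      · rwa [Set.mem_ofPred_eq, forestCoeff_of_mem t hi] at hF

/-- The family `D` is dual to the functionals `forestCoeff t`. -/
def IsDualFamily (t : ℕ → R) (D : IndexedForest → MvPolynomial ℕ R) : Prop :=
  ∀ F G, forestCoeff t G (D F) = open Classical in if G = F then 1 else 0

theorem IsDualFamily.eq {t : ℕ → R} {D D' : IndexedForest → MvPolynomial ℕ R}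
    (h : IsDualFamily t D) (h' : IsDualFamily t D') : D = D' :=
  funext fun F => ext_forestCoeff (t := t) fun G => by rw [h, h']

/-- The substitution `φ i` turns the functional for `t` into the one for `removeAt i t`, and it
fixes the values `0` and `1`, so it leaves no trace in the duality. -/
theorem isDualFamily_of_trimOp {t : ℕ → R} {φ : ℕ → R →+* R}
    (hφ : ∀ i j, φ i (t j) = removeAt i t j) {D : IndexedForest → MvPolynomial ℕ R}
    (h1 : eval t (D .empty) = 1) (h0 : ∀ F, F ≠ .empty → eval t (D F) = 0)
    (hmem : ∀ F, ∀ i ∈ F.qdes, trimOp i (t i) (D F) = map (φ i) (D (F.trim i)))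
    (hnot : ∀ F, ∀ i ∉ F.qdes, trimOp i (t i) (D F) = 0) : IsDualFamily t D := by
  intro F G
  induction G using grow_induction generalizing F with
  | empty =>
    rw [forestCoeff_empty]
    by_cases hF : F = .empty
    · rw [hF, if_pos rfl, h1]
    · rw [if_neg (Ne.symm hF), h0 F hF]
  | grow i G ih =>
    rw [forestCoeff_grow]
    by_cases hi : i ∈ F.qdes
    · rw [hmem F i hi, ← map_forestCoeff (φ i) (hφ i), ih]
      have : G = F.trim i ↔ grow i G = F :=
        ⟨fun h => by rw [h, grow_trim hi], fun h => by rw [← h, trim_grow]⟩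
      by_cases hG : grow i G = F
      · rw [if_pos (this.2 hG), if_pos hG, map_one]
      · rw [if_neg fun h' => hG (this.1 h'), if_neg hG, map_zero]
    · rw [hnot F i hi, map_zero, if_neg]
      rintro rfl
      exact hi (mem_qdes_grow i G)

theorem IsDualFamily.trimOp_mem {t : ℕ → R} {φ : ℕ → R →+* R}
    (hφ : ∀ i j, φ i (t j) = removeAt i t j) {D : IndexedForest → MvPolynomial ℕ R}
    (h : IsDualFamily t D) {F : IndexedForest} {i : ℕ} (hi : i ∈ F.qdes) :
    trimOp i (t i) (D F) = map (φ i) (D (F.trim i)) := by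
  refine ext_forestCoeff (t := removeAt i t) fun G => ?_
  rw [← forestCoeff_grow, ← map_forestCoeff (φ i) (hφ i), h, h]
  have : G = F.trim i ↔ grow i G = F :=
    ⟨fun h => by rw [h, grow_trim hi], fun h => by rw [← h, trim_grow]⟩
  by_cases hG : grow i G = F
  · rw [if_pos (this.2 hG), if_pos hG, map_one]
  · rw [if_neg fun h' => hG (this.1 h'), if_neg hG, map_zero]

theorem IsDualFamily.trimOp_notMem {t : ℕ → R} {D : IndexedForest → MvPolynomial ℕ R}
    (h : IsDualFamily t D) {F : IndexedForest} {i : ℕ} (hi : i ∉ F.qdes) :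
    trimOp i (t i) (D F) = 0 := by
  refine eq_zero_of_forestCoeff_eq_zero (t := removeAt i t) fun G => ?_
  rw [← forestCoeff_grow, h, if_neg]
  rintro rfl
  exact hi (mem_qdes_grow i G)

theorem IsDualFamily.mem_supported {t : ℕ → R} {D : IndexedForest → MvPolynomial ℕ R}
    (h : IsDualFamily t D) {F : IndexedForest} {n : ℕ} (hF : F.qdes ⊆ Set.Iio n) :
    D F ∈ supported R (Set.Iio n) :=
  mem_supported_of_trimOp_eq_zero t fun _ hi => h.trimOp_notMem fun hi' => not_lt.2 hi (hF hi')

theorem IsDualFamily.eq_sum {t : ℕ → R} {D : IndexedForest → MvPolynomial ℕ R}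
    (h : IsDualFamily t D) (f : MvPolynomial ℕ R) :
    f = ∑ F ∈ (finite_forestCoeff_ne_zero t f).toFinset, forestCoeff t F f • D F := by
  classical
  refine ext_forestCoeff (t := t) fun G => ?_
  rw [map_sum]
  simp only [map_smul, h _ G, smul_eq_mul, mul_ite, mul_one, mul_zero, Finset.sum_ite_eq,
    Set.Finite.mem_toFinset, Set.mem_ofPred_eq]
  split_ifs with h0
  · rfl
  · exact not_not.1 h0

theorem IsDualFamily.linearIndependent {t : ℕ → R} {D : IndexedForest → MvPolynomial ℕ R}
    (h : IsDualFamily t D) : LinearIndependent R D := by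
  classical
  rw [linearIndependent_iff']
  intro s c hs F hF
  have := congrArg (forestCoeff t F) hs
  rw [map_sum, map_zero] at this
  simpa [h _ F, hF] using this

theorem IsDualFamily.exists_basis {t : ℕ → R} {D : IndexedForest → MvPolynomial ℕ R}
    (h : IsDualFamily t D) :
    ∃ b : Module.Basis IndexedForest R (MvPolynomial ℕ R), ∀ F, b F = D F := by
  refine ⟨Module.Basis.mk h.linearIndependent fun f _ => ?_, fun F => Module.Basis.mk_apply _ _ F⟩
  rw [h.eq_sum f]
  exact Submodule.sum_mem _ fun F _ => Submodule.smul_mem _ _ (Submodule.subset_span ⟨F, rfl⟩)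

theorem IsDualFamily.exists_basis_supported {t : ℕ → R} {D : IndexedForest → MvPolynomial ℕ R}
    (h : IsDualFamily t D) (n : ℕ) :
    ∃ b : Module.Basis {F : IndexedForest // F.qdes ⊆ Set.Iio n} R
        (Subalgebra.toSubmodule (supported R (Set.Iio n))),
      ∀ F, (b F : MvPolynomial ℕ R) = D F := by
  let v : {F : IndexedForest // F.qdes ⊆ Set.Iio n} →
      Subalgebra.toSubmodule (supported R (Set.Iio n)) := fun F => ⟨D F, h.mem_supported F.2⟩
  have hv : LinearIndependent R v := by
    refine LinearIndependent.of_comp (Submodule.subtype _) ?_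
    exact h.linearIndependent.comp _ Subtype.val_injective
  refine ⟨Module.Basis.mk hv ?_, fun F => by rw [Module.Basis.mk_apply]⟩
  rintro ⟨f, hf⟩ -
  -- A flag `i ≥ n` would allow trimming at `i` first, which kills every polynomial in the first `n`
  -- variables.
  have hsub : ∀ F, forestCoeff t F f ≠ 0 → F.qdes ⊆ Set.Iio n := by
    intro F hF i hi
    by_contra hin
    exact hF (forestCoeff_of_mem_supported t hi (not_lt.1 hin) hf)
  have hsum : (⟨f, hf⟩ : Subalgebra.toSubmodule (supported R (Set.Iio n)))
      = ∑ F ∈ (finite_forestCoeff_ne_zero t f).toFinset.attach,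
        forestCoeff t F f • v ⟨F, hsub F ((Set.Finite.mem_toFinset _).1 F.2)⟩ := by
    refine Subtype.ext ?_
    rw [Submodule.coe_sum]
    refine (h.eq_sum f).trans (Finset.sum_attach _ _).symm
  rw [hsum]
  exact Submodule.sum_mem _ fun F _ => Submodule.smul_mem _ _ (Submodule.subset_span ⟨_, rfl⟩)

end Functionals

/-! ### Ordinary forest polynomials -/

section Ordinary

variable {R : Type*} [CommRing R]

theorem isHomogeneous_ins_zero {d : ℕ} {f : MvPolynomial ℕ R} (hf : f.IsHomogeneous d) (i : ℕ) :
    (ins i 0 f).IsHomogeneous d := by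
  rw [← one_mul d]
  refine hf.aeval _ fun j => ?_
  split_ifs
  · exact isHomogeneous_X _ _
  · rw [C_0]
    exact isHomogeneous_zero _ _ _
  · exact isHomogeneous_X _ _

theorem eval_zero_of_isHomogeneous {d : ℕ} (hd : d ≠ 0) {f : MvPolynomial ℕ R}
    (hf : f.IsHomogeneous d) : eval (fun _ => (0 : R)) f = 0 := by
  have h : eval (fun _ => (0 : R)) f = coeff 0 f := by
    rw [← constantCoeff_eq]
    simp [constantCoeff, ← Pi.zero_def, eval_zero]
  rw [h]
  exact hf.coeff_eq_zero (by simpa using hd.symm)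

variable [IsDomain R]

theorem trimOp_ins_zero (j : ℕ) (a : R) (f : MvPolynomial ℕ R) :
    trimOp j a (ins 0 a f) = ins 0 a (trimOp (j + 1) a f) := by
  apply trimOp_eq
  rw [← ins_ins (Nat.zero_le _), ← ins_ins (Nat.zero_le _), ← map_sub, ← trimOp_spec, map_mul,
    map_sub, ins_X_succ (Nat.zero_le _), ins_C]

theorem trimOp_iterate_ins_zero (j k : ℕ) (a : R) (f : MvPolynomial ℕ R) :
    trimOp j a ((ins 0 a)^[k] f) = (ins 0 a)^[k] (trimOp (j + k) a f) := by
  induction k generalizing j with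
  | zero => rfl
  | succ k ih =>
    rw [Function.iterate_succ_apply', Function.iterate_succ_apply', trimOp_ins_zero, ih,
      show j + 1 + k = j + (k + 1) by omega]

theorem X_mul_trimOp_zero (i : ℕ) (f : MvPolynomial ℕ R) :
    X i * trimOp i 0 f = ins (i + 1) 0 f - ins i 0 f := by
  rw [← trimOp_spec, C_0, sub_zero]

/-- By Leibniz and `hcomp`, the terms with `i < j` telescope in insertions into `g (j + 1)` and
those with `i > j + 1` in insertions into `g j`. The terms `i = j` and `i = j + 1` cancel the inner
ends. -/
theorem trimOp_sum_X_mul {g : ℕ → MvPolynomial ℕ R} {m : ℕ} (hfin : ∀ i, m ≤ i → g i = 0)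
    (hcomp : ∀ i k, i < k → trimOp k 0 (g i) = trimOp i 0 (g (k + 1))) (j : ℕ) :
    trimOp j 0 (∑ i ∈ Finset.range m, X i * g i) = g j - ins 0 0 (g (j + 1)) := by
  obtain ⟨n, hn⟩ := exists_mem_supported (g j)
  -- The range is lengthened past `j + 1` and past the variables of `g j`, so that the outermost
  -- insertion fixes `g j`.
  have h1 : ∑ i ∈ Finset.range m, X i * g i
      = ∑ i ∈ Finset.range (j + 1 + 1 + (m + n)), X i * g i := by
    refine Finset.sum_subset (Finset.range_mono (by omega)) fun i _ hi => ?_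
    rw [hfin i (by simpa using hi), mul_zero]
  rw [h1, Finset.sum_range_add, Finset.sum_range_succ, Finset.sum_range_succ, map_add, map_add,
    map_add, map_sum, map_sum]
  have h2 : ∀ i ∈ Finset.range j, trimOp j 0 (X i * g i)
      = ins (i + 1) 0 (g (j + 1)) - ins i 0 (g (j + 1)) := by
    intro i hi
    rw [Finset.mem_range] at hi
    rw [trimOp_mul, trimOp_X_of_lt hi, ins_X_of_lt hi, zero_mul, zero_add, hcomp i j hi,
      X_mul_trimOp_zero]
  have h3 : ∀ i ∈ Finset.range (m + n), trimOp j 0 (X (j + 1 + 1 + i) * g (j + 1 + 1 + i))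
      = ins (j + 1 + (i + 1)) 0 (g j) - ins (j + 1 + i) 0 (g j) := by
    intro i _
    rw [show j + 1 + 1 + i = j + 1 + i + 1 by omega, trimOp_mul, trimOp_X_of_gt (by omega),
      ins_X_succ (by omega), zero_mul, zero_add, ← hcomp j (j + 1 + i) (by omega),
      X_mul_trimOp_zero]
    rfl
  rw [Finset.sum_congr rfl h2, Finset.sum_range_sub (fun i => ins i 0 (g (j + 1))),
    Finset.sum_congr rfl h3, Finset.sum_range_sub (fun i => ins (j + 1 + i) 0 (g j)),
    trimOp_mul, trimOp_mul, trimOp_X_self, trimOp_X_succ_self, ins_X_self, ins_X_succ le_rfl,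
    X_mul_trimOp_zero, C_0, ins_of_mem_supported (i := j + 1 + (m + n)) (by omega) 0 hn, add_zero]
  ring

/-- A family of polynomials is of the form `(T_i f)_i` as soon as it satisfies the relations that
the commutation relations of the trimming operations impose. -/
theorem exists_trimOp_zero_eq {g : ℕ → MvPolynomial ℕ R} {m d : ℕ}
    (hfin : ∀ i, m ≤ i → g i = 0) (hhom : ∀ i, (g i).IsHomogeneous d)
    (hcomp : ∀ i k, i < k → trimOp k 0 (g i) = trimOp i 0 (g (k + 1))) :
    ∃ f : MvPolynomial ℕ R, f.IsHomogeneous (d + 1) ∧ ∀ i, trimOp i 0 f = g i := by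
  -- The inner sum solves the equations up to the error `ins 0 0 (g (j + 1))`. Summing its iterates
  -- under `ins 0 0` makes the errors telescope, and the last one vanishes by `hfin`.
  refine ⟨∑ k ∈ Finset.range m, (ins 0 0)^[k] (∑ i ∈ Finset.range m, X i * g i), ?_, fun j => ?_⟩
  · refine IsHomogeneous.sum _ _ _ fun k hk => ?_
    clear hk
    induction k with
    | zero =>
      refine IsHomogeneous.sum _ _ _ fun i _ => ?_
      rw [add_comm]
      exact (isHomogeneous_X _ _).mul (hhom i)
    | succ k ih =>
      rw [Function.iterate_succ_apply']
      exact isHomogeneous_ins_zero ih 0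
  · rw [map_sum]
    have h : ∀ k ∈ Finset.range m, trimOp j 0 ((ins 0 0)^[k] (∑ i ∈ Finset.range m, X i * g i))
        = (ins 0 0)^[k] (g (j + k)) - (ins 0 0)^[k + 1] (g (j + (k + 1))) := by
      intro k _
      rw [trimOp_iterate_ins_zero, trimOp_sum_X_mul hfin hcomp, iterate_map_sub,
        Function.iterate_succ_apply]
      rfl
    rw [Finset.sum_congr rfl h,
      Finset.sum_range_sub' (fun k => (ins (0 : ℕ) (0 : R))^[k] (g (j + k))),
      hfin (j + m) (by omega), iterate_map_zero, sub_zero]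
    rfl

variable (R) in
/-- The forest polynomials of the forests with `n` internal nodes. -/
noncomputable def ordAux : ℕ → IndexedForest → MvPolynomial ℕ R
  | 0, _ => 1
  | n + 1, F => Classical.epsilon fun f => f.IsHomogeneous (n + 1) ∧
      ∀ i, trimOp i 0 f = open Classical in if i ∈ F.qdes then ordAux n (F.trim i) else 0

theorem ordAux_spec (F : IndexedForest) : (ordAux R F.size F).IsHomogeneous F.size ∧
    ∀ i, trimOp i 0 (ordAux R F.size F)
      = open Classical in if i ∈ F.qdes then ordAux R (F.trim i).size (F.trim i) else 0 := by
  classical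
  induction h : F.size using Nat.strong_induction_on generalizing F with
  | _ n ih =>
    subst h
    by_cases hF : F = .empty
    · subst hF
      rw [size_empty, ordAux, ← C_1]
      refine ⟨isHomogeneous_C _ _, fun i => ?_⟩
      simp only [trimOp_C, qdes_empty, Set.mem_empty_iff_false, if_false]
    · obtain ⟨n, hn⟩ := Nat.exists_eq_add_of_lt (size_pos hF)
      rw [zero_add] at hn
      have hsize : ∀ i ∈ F.qdes, (F.trim i).size = n := fun i hi => by
        have := size_trim hi
        omega
      have hlt : ∀ i ∈ F.qdes, (F.trim i).size < F.size := fun i hi => by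
        have := size_trim hi
        omega
      have main : ∃ f : MvPolynomial ℕ R, f.IsHomogeneous (n + 1) ∧
          ∀ i, trimOp i 0 f = if i ∈ F.qdes then ordAux R n (F.trim i) else 0 := by
        obtain ⟨m, hm⟩ := qdes_bddAbove F
        refine exists_trimOp_zero_eq (m := m) (fun i hi => ?_) (fun i => ?_) fun i k hik => ?_
        · exact if_neg fun h' => not_lt.2 hi (hm i h')
        · split_ifs with hi
          · have := (ih _ (hlt i hi) _ rfl).1
            rwa [hsize i hi] at this
          · exact isHomogeneous_zero _ _ _
        · have hstep : ∀ i k, trimOp k 0 (if i ∈ F.qdes then ordAux R n (F.trim i) else 0)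
              = if i ∈ F.qdes ∧ k ∈ (F.trim i).qdes then
                  ordAux R ((F.trim i).trim k).size ((F.trim i).trim k) else 0 := by
            intro i k
            by_cases hi : i ∈ F.qdes
            · have := (ih _ (hlt i hi) _ rfl).2 k
              rw [hsize i hi] at this
              simp only [hi, if_true, this, true_and]
            · simp only [hi, if_false, map_zero, false_and]
          rw [hstep, hstep]
          -- Each side is nontrivial only when both nodes can be removed, in the corresponding
          -- order; both are then the polynomial of the same remaining forest.
          by_cases hG : ∃ G, F = grow i (grow k G)
          · obtain ⟨G, rfl⟩ := hG
            rw [if_pos ⟨mem_qdes_grow _ _, by rw [trim_grow]; exact mem_qdes_grow _ _⟩,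
              trim_grow, trim_grow, grow_grow hik,
              if_pos ⟨mem_qdes_grow _ _, by rw [trim_grow]; exact mem_qdes_grow _ _⟩,
              trim_grow, trim_grow]
          · rw [if_neg fun h' => hG ⟨(F.trim i).trim k, by rw [grow_trim h'.2, grow_trim h'.1]⟩,
              if_neg fun h' => hG ⟨(F.trim (k + 1)).trim i, by
                rw [grow_grow hik, grow_trim h'.2, grow_trim h'.1]⟩]
      rw [hn, ordAux]
      refine ⟨(Classical.epsilon_spec main).1, fun i => ?_⟩
      rw [(Classical.epsilon_spec main).2 i]
      split_ifs with hi
      · rw [hsize i hi]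
      · rfl

variable (R) in
theorem isDualFamily_ordAux : IsDualFamily (fun _ => (0 : R)) fun F => ordAux R F.size F := by
  refine isDualFamily_of_trimOp (φ := fun _ => RingHom.id R) (fun i j => by simp [removeAt])
    (by simp [ordAux]) (fun F hF => eval_zero_of_isHomogeneous (size_pos hF).ne' (ordAux_spec F).1)
    (fun F i hi => ?_) fun F i hi => ?_
  · rw [(ordAux_spec F).2, if_pos hi, map_id]
  · rw [(ordAux_spec F).2, if_neg hi]

end Ordinary

/-! ### Forest families as dual families at `t = 0` -/

theorem bs_eq_ins (i : ℕ) (f : Poly) : bs i f = ins i 0 f := by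
  rw [bs, ins, C_0]

theorem ordTrim_eq_trimOp (i : ℕ) (f : Poly) : ordTrim i f = trimOp i 0 f := by
  symm
  apply trimOp_eq
  rw [← bs_eq_ins, ← bs_eq_ins, ordTrim_spec, C_0, sub_zero]

theorem IsForestFamily.ne_zero {P : IndexedForest → Poly} (h : IsForestFamily P)
    (F : IndexedForest) : P F ≠ 0 := by
  induction F using grow_induction with
  | empty =>
    rw [h.empty]
    exact one_ne_zero
  | grow i F ih =>
    intro h0
    have := h.ordTrim_mem _ i (mem_qdes_grow i F)
    rw [h0, ordTrim_eq_trimOp, map_zero, trim_grow] at this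
    exact ih this.symm

theorem IsForestFamily.isDualFamily {P : IndexedForest → Poly} (h : IsForestFamily P) :
    IsDualFamily (fun _ => 0) P := by
  refine isDualFamily_of_trimOp (φ := fun _ => RingHom.id ℤ) (fun i j => by simp [removeAt])
    (by simp [h.empty]) (fun F hF => ?_) (fun F i hi => ?_) fun F i hi => ?_
  · obtain ⟨d, hd⟩ := h.homog F
    -- The degree `d` is not prescribed, so `d = 0` must be excluded: a constant has zero trims,
    -- whereas some trim of `P F` is a nonzero member of the family.
    refine eval_zero_of_isHomogeneous (fun h0 => ?_) hd
    obtain ⟨i, hi⟩ := qdes_nonempty hF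
    refine h.ne_zero (F.trim i) ?_
    rw [← h.ordTrim_mem F i hi, ordTrim_eq_trimOp]
    subst h0
    rw [← totalDegree_zero_iff_isHomogeneous, totalDegree_eq_zero_iff_eq_C] at hd
    rw [hd, trimOp_C]
  · rw [← ordTrim_eq_trimOp, h.ordTrim_mem F i hi, map_id]
  · rw [← ordTrim_eq_trimOp, h.ordTrim_notMem F i hi]

theorem isForestFamily_ordAux : IsForestFamily fun F => ordAux ℤ F.size F where
  homog F := ⟨_, (ordAux_spec F).1⟩
  empty := by simp [ordAux]
  ordTrim_mem F i hi := by rw [ordTrim_eq_trimOp, (ordAux_spec F).2, if_pos hi]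
  ordTrim_notMem F i hi := by rw [ordTrim_eq_trimOp, (ordAux_spec F).2, if_neg hi]

/-! ### Homogeneity with respect to both sets of variables -/

/-- Compare homogeneous components of `p * q`. Speaking of exponents covers `n < m` as well, where
it forces `q = 0`; both cases are needed for trimming. -/
theorem isHomogeneous_of_mul {σ R : Type*} [CommRing R] [IsDomain R] {p q : MvPolynomial σ R}
    {m n : ℕ} (hp : p.IsHomogeneous m) (hp0 : p ≠ 0) (hpq : (p * q).IsHomogeneous n)
    {d : σ →₀ ℕ} (hd : coeff d q ≠ 0) : m + d.degree = n := by
  have key : ∀ k, homogeneousComponent (m + k) (p * q) = p * homogeneousComponent k q := by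
    intro k
    conv_lhs => rw [← sum_homogeneousComponent q, Finset.mul_sum, map_sum]
    have h : ∀ j ∈ Finset.range (q.totalDegree + 1),
        homogeneousComponent (m + k) (p * homogeneousComponent j q)
          = if j = k then p * homogeneousComponent k q else 0 := by
      intro j _
      rw [homogeneousComponent_of_mem (hp.mul (homogeneousComponent_isHomogeneous j q))]
      by_cases hj : j = k
      · simp [hj]
      · simp [hj, Ne.symm hj]
    rw [Finset.sum_congr rfl h, Finset.sum_ite_eq']
    split_ifs with h'
    · rfl
    · rw [homogeneousComponent_eq_zero _ _ (by simpa using h'), mul_zero]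
  by_contra hne
  have h1 := key d.degree
  rw [homogeneousComponent_of_mem hpq, if_neg hne] at h1
  have h2 := (mul_eq_zero.1 h1.symm).resolve_left hp0
  have h3 := coeff_homogeneousComponent d.degree q d
  rw [h2, if_pos rfl, coeff_zero] at h3
  exact hd h3.symm

/-- `f` is homogeneous of degree `d` in all the variables `x` and `t`. -/
def IsHomogOfDegree (d : ℕ) (f : PolyTX) : Prop :=
  ((sumAlgEquiv ℤ ℕ ℕ).symm f).IsHomogeneous d

theorem symm_C (r : Poly) : (sumAlgEquiv ℤ ℕ ℕ).symm (C r) = rename Sum.inr r := by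
  rw [AlgEquiv.symm_apply_eq]
  exact (DFunLike.congr_fun (sumAlgEquiv_comp_rename_inr (R := ℤ) (S₁ := ℕ) (S₂ := ℕ)) r).symm

theorem symm_map_C (q : Poly) : (sumAlgEquiv ℤ ℕ ℕ).symm (map C q) = rename Sum.inl q := by
  induction q using MvPolynomial.induction_on with
  | C r => simp
  | add p q hp hq => simp only [map_add, hp, hq]
  | mul_X p j hp => simp only [map_mul, hp, map_X, rename_X, sumAlgEquiv_symm_X]

theorem IsHomogOfDegree.sub {d : ℕ} {f g : PolyTX} (hf : IsHomogOfDegree d f)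
    (hg : IsHomogOfDegree d g) : IsHomogOfDegree d (f - g) := by
  unfold IsHomogOfDegree
  rw [map_sub]
  exact IsHomogeneous.sub hf hg

theorem IsHomogOfDegree.sum {ι : Type*} {d : ℕ} {s : Finset ι} {f : ι → PolyTX}
    (h : ∀ i ∈ s, IsHomogOfDegree d (f i)) : IsHomogOfDegree d (∑ i ∈ s, f i) := by
  unfold IsHomogOfDegree
  rw [map_sum]
  exact IsHomogeneous.sum _ _ _ h

theorem IsHomogOfDegree.smul {d e : ℕ} {r : Poly} {f : PolyTX} (hr : r.IsHomogeneous e)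
    (hf : IsHomogOfDegree d f) : IsHomogOfDegree (e + d) (r • f) := by
  unfold IsHomogOfDegree
  rw [smul_eq_C_mul, map_mul, symm_C]
  exact hr.rename_isHomogeneous.mul hf

theorem isHomogOfDegree_C {d : ℕ} {r : Poly} : IsHomogOfDegree d (C r) ↔ r.IsHomogeneous d := by
  unfold IsHomogOfDegree
  rw [symm_C]
  exact IsHomogeneous.rename_isHomogeneous_iff Sum.inr_injective

theorem isHomogOfDegree_map_C {d : ℕ} {q : Poly} (hq : q.IsHomogeneous d) :
    IsHomogOfDegree d (map C q) := by
  unfold IsHomogOfDegree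
  rw [symm_map_C]
  exact hq.rename_isHomogeneous

theorem isHomogOfDegree_X (i : ℕ) : IsHomogOfDegree 1 (X i) := by
  unfold IsHomogOfDegree
  rw [sumAlgEquiv_symm_X]
  exact isHomogeneous_X _ _

/-- Substituting linear forms for the variables `x` preserves homogeneity. -/
theorem IsHomogOfDegree.aeval {d : ℕ} {f : PolyTX} (hf : IsHomogOfDegree d f) {u : ℕ → PolyTX}
    (hu : ∀ j, IsHomogOfDegree 1 (u j)) :
    IsHomogOfDegree d (MvPolynomial.aeval u f) := by
  have h : (sumAlgEquiv ℤ ℕ ℕ).symm (MvPolynomial.aeval u f)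
      = MvPolynomial.aeval
        (Sum.elim (fun j => (sumAlgEquiv ℤ ℕ ℕ).symm (u j)) fun j => X (Sum.inr j))
        ((sumAlgEquiv ℤ ℕ ℕ).symm f) := by
    clear hf
    obtain ⟨p, rfl⟩ := (sumAlgEquiv ℤ ℕ ℕ).surjective f
    rw [AlgEquiv.symm_apply_apply]
    induction p using MvPolynomial.induction_on with
    | C r => simp
    | add p q hp hq => simp only [map_add, hp, hq]
    | mul_X p j hp =>
      simp only [map_mul, hp, aeval_X]
      congr 1
      rcases j with j | j <;> simp
  unfold IsHomogOfDegree
  rw [h, ← one_mul d]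
  refine IsHomogeneous.aeval hf _ fun j => ?_
  rcases j with j | j
  · exact hu j
  · exact isHomogeneous_X _ _

theorem IsHomogOfDegree.ins {d : ℕ} {f : PolyTX} (hf : IsHomogOfDegree d f) (i : ℕ) {a : Poly}
    (ha : a.IsHomogeneous 1) : IsHomogOfDegree d (ins i a f) := by
  refine hf.aeval fun j => ?_
  split_ifs
  · exact isHomogOfDegree_X j
  · exact isHomogOfDegree_C.2 ha
  · exact isHomogOfDegree_X _

theorem IsHomogOfDegree.isHomogeneous_eval {d : ℕ} {f : PolyTX} (hf : IsHomogOfDegree d f)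
    {t : ℕ → Poly} (ht : ∀ j, (t j).IsHomogeneous 1) : (eval t f).IsHomogeneous d := by
  rw [← isHomogOfDegree_C]
  have h : C (eval t f) = MvPolynomial.aeval (fun j => (C (t j) : PolyTX)) f := by
    rw [← aeval_eq_eval, ← algebraMap_eq]
    exact (aeval_algebraMap_apply (R := Poly) (A := Poly) PolyTX t f).symm
  rw [h]
  exact hf.aeval fun j => isHomogOfDegree_C.2 (ht j)

theorem IsHomogOfDegree.degree_of_trimOp {d : ℕ} {f : PolyTX} (hf : IsHomogOfDegree d f) (i : ℕ)
    {a : Poly} (ha : a.IsHomogeneous 1) {m : ℕ ⊕ ℕ →₀ ℕ}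
    (hm : coeff m ((sumAlgEquiv ℤ ℕ ℕ).symm (trimOp i a f)) ≠ 0) : 1 + m.degree = d := by
  have h : IsHomogOfDegree d ((X i - C a) * trimOp i a f) := by
    rw [trimOp_spec]
    exact (hf.ins _ ha).sub (hf.ins _ ha)
  unfold IsHomogOfDegree at h
  rw [map_mul] at h
  refine isHomogeneous_of_mul ((isHomogOfDegree_X i).sub (isHomogOfDegree_C.2 ha)) ?_ h hm
  rw [ne_eq, EmbeddingLike.map_eq_zero_iff]
  exact X_sub_C_ne_zero i a

theorem IsHomogOfDegree.trimOp {d : ℕ} {f : PolyTX} (hf : IsHomogOfDegree (d + 1) f) (i : ℕ)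
    {a : Poly} (ha : a.IsHomogeneous 1) : IsHomogOfDegree d (trimOp i a f) := by
  unfold IsHomogOfDegree
  intro m hm
  have := hf.degree_of_trimOp i ha hm
  have h : m.degree = Finsupp.weight 1 m := DFunLike.congr_fun Finsupp.degree_eq_weight_one m
  omega

theorem IsHomogOfDegree.trimOp_eq_zero {f : PolyTX} (hf : IsHomogOfDegree 0 f) (i : ℕ)
    {a : Poly} (ha : a.IsHomogeneous 1) : DoubleForest.trimOp i a f = 0 := by
  rw [← EmbeddingLike.map_eq_zero_iff (f := (sumAlgEquiv ℤ ℕ ℕ).symm)]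
  ext m
  rw [coeff_zero]
  by_contra hm
  have := hf.degree_of_trimOp i ha hm
  omega

theorem isHomogeneous_removeAt {t : ℕ → Poly} (ht : ∀ j, (t j).IsHomogeneous 1) (i j : ℕ) :
    (removeAt i t j).IsHomogeneous 1 := by
  unfold removeAt
  split_ifs <;> exact ht _

theorem IsHomogOfDegree.forestCoeff {d : ℕ} {f : PolyTX} {F : IndexedForest}
    (hf : IsHomogOfDegree (d + F.size) f) {t : ℕ → Poly} (ht : ∀ j, (t j).IsHomogeneous 1) :
    (forestCoeff t F f).IsHomogeneous d := by
  induction F using grow_induction generalizing t f with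
  | empty =>
    rw [forestCoeff_empty]
    rw [size_empty] at hf
    exact hf.isHomogeneous_eval ht
  | grow i F ih =>
    rw [forestCoeff_grow]
    rw [size_grow] at hf
    exact ih (hf.trimOp i (ht i)) (isHomogeneous_removeAt ht i)

theorem IsHomogOfDegree.forestCoeff_eq_zero {d : ℕ} {f : PolyTX} {F : IndexedForest}
    (hf : IsHomogOfDegree d f) (hd : d < F.size) {t : ℕ → Poly}
    (ht : ∀ j, (t j).IsHomogeneous 1) : DoubleForest.forestCoeff t F f = 0 := by
  induction F using grow_induction generalizing t f d with
  | empty => simp at hd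
  | grow i F ih =>
    rw [forestCoeff_grow]
    rw [size_grow] at hd
    rcases d with _ | d
    · rw [hf.trimOp_eq_zero i (ht i), map_zero]
    · exact ih (hf.trimOp i (ht i)) (by omega) (isHomogeneous_removeAt ht i)

/-! ### Double forest polynomials -/

/-- The left side is homogeneous of degree `0` in `t`, hence an integer, and setting `t = 0` does
not change it. -/
theorem forestCoeff_map_C {d : ℕ} {q : Poly} (hq : q.IsHomogeneous d) {F : IndexedForest}
    (hF : F.size = d) :
    forestCoeff X F (map C q : PolyTX) = C (forestCoeff (fun _ => 0) F q) := by
  have h1 : (forestCoeff X F (map C q : PolyTX)).IsHomogeneous 0 :=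
    IsHomogOfDegree.forestCoeff (by rw [zero_add, hF]; exact isHomogOfDegree_map_C hq)
      (isHomogeneous_X ℤ)
  rw [← totalDegree_zero_iff_isHomogeneous, totalDegree_eq_zero_iff_eq_C] at h1
  have h2 := map_forestCoeff (eval fun _ => (0 : ℤ)) (t := X) (s := fun _ => 0) (by simp) F
    (map C q : PolyTX)
  have h3 : (eval fun _ : ℕ => (0 : ℤ)).comp C = RingHom.id ℤ := by
    ext
    simp
  rw [map_map, h3, map_id, h1, eval_C] at h2
  rw [h1, h2]

theorem exists_dual (F : IndexedForest) :
    ∃ f : PolyTX, IsHomogOfDegree F.size f ∧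
      ∀ G, forestCoeff X G f = open Classical in if G = F then 1 else 0 := by
  classical
  induction h : F.size using Nat.strong_induction_on generalizing F with
  | _ n ih =>
    subst h
    choose D hD1 hD2 using fun G (hG : G.size < F.size) => ih _ hG G rfl
    -- This first approximation has the right values on forests at least as large as `F`: zero for
    -- degree reasons on larger ones, the ordinary duality on equal size. Only smaller forests need
    -- correcting.
    set q : PolyTX := map C (ordAux ℤ F.size F)
    have hq : IsHomogOfDegree F.size q := isHomogOfDegree_map_C (ordAux_spec F).1
    let s := (finite_forestCoeff_ne_zero X q).toFinset.filter fun G => G.size < F.size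
    have hs : ∀ G ∈ s, G.size < F.size := fun G hG => (Finset.mem_filter.1 hG).2
    refine ⟨q - ∑ G ∈ s.attach, forestCoeff X G.1 q • D G.1 (hs _ G.2), ?_, fun H => ?_⟩
    · refine hq.sub (IsHomogOfDegree.sum fun G _ => ?_)
      have hG := hs _ G.2
      have h1 : (forestCoeff X G.1 q).IsHomogeneous (F.size - G.1.size) :=
        IsHomogOfDegree.forestCoeff (by rwa [Nat.sub_add_cancel hG.le]) (isHomogeneous_X ℤ)
      have h2 := IsHomogOfDegree.smul h1 (hD1 _ hG)
      rwa [Nat.sub_add_cancel hG.le] at h2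
    · rw [map_sub, map_sum]
      have h1 : ∀ G ∈ s.attach, forestCoeff X H (forestCoeff X G.1 q • D G.1 (hs _ G.2))
          = if H = G.1 then forestCoeff X G.1 q else 0 := by
        intro G _
        rw [map_smul, hD2, smul_eq_mul, mul_ite, mul_one, mul_zero]
      rw [Finset.sum_congr rfl h1,
        Finset.sum_attach s fun G => if H = G then forestCoeff X G q else 0, Finset.sum_ite_eq]
      rcases lt_trichotomy H.size F.size with hH | hH | hH
      · have hne : H ≠ F := fun h => hH.ne (by rw [h])
        rw [if_neg hne]
        split_ifs with hHs
        · exact sub_self _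
        · rw [sub_zero]
          by_contra h0
          exact hHs (Finset.mem_filter.2 ⟨(Set.Finite.mem_toFinset _).2 h0, hH⟩)
      · rw [if_neg fun hHs => (hs H hHs).ne hH, sub_zero,
          forestCoeff_map_C (ordAux_spec F).1 hH, isDualFamily_ordAux ℤ F H]
        split_ifs <;> simp
      · have hne : H ≠ F := fun h => hH.ne (by rw [h])
        rw [if_neg fun hHs => (hs H hHs).not_gt hH, sub_zero, if_neg hne]
        exact hq.forestCoeff_eq_zero hH (isHomogeneous_X ℤ)

theorem rMinus_eq_ins (i : ℕ) (f : PolyTX) : rMinus i f = ins i (X i) f := rfl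

theorem rPlus_eq_ins (i : ℕ) (f : PolyTX) : rPlus i f = ins (i + 1) (X i) f := by
  rw [rPlus, ins]
  simp only [Nat.lt_succ_iff]

theorem eqTrim_eq_trimOp (i : ℕ) (f : PolyTX) : eqTrim i f = trimOp i (X i) f := by
  symm
  apply trimOp_eq
  rw [← rMinus_eq_ins, ← rPlus_eq_ins, eqTrim_spec]

/-- The substitution `t ↦ t̂_i` on `ℤ[t]`. -/
noncomputable def hatRingHom (i : ℕ) : Poly →+* Poly :=
  (rename (fun j => if j < i then j else j + 1) : Poly →ₐ[ℤ] Poly).toRingHom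

theorem hatRingHom_X (i j : ℕ) : hatRingHom i (X j) = removeAt i X j := by
  unfold hatRingHom removeAt
  change rename _ _ = _
  rw [rename_X]
  split_ifs <;> rfl

theorem IsDoubleForestFamily.isDualFamily {D : IndexedForest → PolyTX}
    (h : IsDoubleForestFamily D) : IsDualFamily X D := by
  refine isDualFamily_of_trimOp hatRingHom_X h.evalT_empty h.evalT_ne (fun F i hi => ?_)
    fun F i hi => ?_
  · rw [← eqTrim_eq_trimOp, h.eqTrim_mem F i hi]
    rfl
  · rw [← eqTrim_eq_trimOp, h.eqTrim_notMem F i hi]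

theorem exists_isDoubleForestFamily : ∃ D, IsDoubleForestFamily D := by
  choose D hD1 hD2 using exists_dual
  have hD : IsDualFamily X D := hD2
  refine ⟨D, fun F => ⟨_, hD1 F⟩, ?_, fun F hF => ?_, fun F i hi => ?_, fun F i hi => ?_⟩
  · have := hD .empty .empty
    rwa [forestCoeff_empty, if_pos rfl] at this
  · have := hD F .empty
    rwa [forestCoeff_empty, if_neg hF.symm] at this
  · rw [eqTrim_eq_trimOp]
    exact hD.trimOp_mem hatRingHom_X hi
  · rw [eqTrim_eq_trimOp]
    exact hD.trimOp_notMem hi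

theorem isDoubleForestFamily_doubleForestPoly : IsDoubleForestFamily doubleForestPoly :=
  Classical.epsilon_spec exists_isDoubleForestFamily

theorem isForestFamily_forestPoly : IsForestFamily forestPoly :=
  Classical.epsilon_spec ⟨_, isForestFamily_ordAux⟩

/-- Duality survives the specialization `t = 0`, so uniqueness of the dual family identifies the
result with the ordinary forest polynomials. -/
theorem isDualFamily_setTZero :
    IsDualFamily (fun _ => 0) fun F => setTZero (doubleForestPoly F) := by
  intro F G
  have h := map_forestCoeff (eval fun _ => (0 : ℤ)) (t := X) (s := fun _ => 0) (by simp) G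
    (doubleForestPoly F)
  change forestCoeff _ _ (map _ _) = _
  rw [← h, isDoubleForestFamily_doubleForestPoly.isDualFamily]
  split_ifs <;> simp

end DoubleForest

theorem corollary4p5 :
    -- the double forest polynomials and the forest polynomials are well defined
    (∃! D, DoubleForest.IsDoubleForestFamily D) ∧
    (∃! P, DoubleForest.IsForestFamily P) ∧
    -- specialization at `t = 0`
    (∀ F : DoubleForest.IndexedForest,
      DoubleForest.setTZero (DoubleForest.doubleForestPoly F) = DoubleForest.forestPoly F) ∧
    -- a basis of `ℤ[t][x]` over `ℤ[t]`
    (∃ b : Module.Basis DoubleForest.IndexedForest DoubleForest.Poly DoubleForest.PolyTX,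
      ∀ F, b F = DoubleForest.doubleForestPoly F) ∧
    -- a basis of `ℤ[t][x₁, …, x_n]` over `ℤ[t]`
    (∀ n : ℕ,
      ∃ b : Module.Basis {F : DoubleForest.IndexedForest // F.qdes ⊆ Set.Iio n}
          DoubleForest.Poly (DoubleForest.polyTXn n),
        ∀ F, (b F : DoubleForest.PolyTX) = DoubleForest.doubleForestPoly F) := by
  have hD := DoubleForest.isDoubleForestFamily_doubleForestPoly
  have hP := DoubleForest.isForestFamily_forestPoly
  exact ⟨⟨_, hD, fun _ h => h.isDualFamily.eq hD.isDualFamily⟩,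
    ⟨_, hP, fun _ h => h.isDualFamily.eq hP.isDualFamily⟩,
    congrFun (DoubleForest.isDualFamily_setTZero.eq hP.isDualFamily),
    hD.isDualFamily.exists_basis, hD.isDualFamily.exists_basis_supported⟩
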